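/- Let $\Sigma_x\in\mathbb{R}^{p\times p}$ be symmetric positive definite and let the state be $x\sim N(0,\Sigma_x)$. For $i\in\{1,2,r\}$ let $Q_i\in\mathbb{R}^{q\times p}$, $R_i\in\mathbb{R}^{q\times t}$, with $R_r^\top R_r$ invertible. A sender policy is a Borel measurable map $\eta:\mathbb{R}^p\to\mathbb{R}^p$, whose signal is $y=\eta(x)$; the receiver sees the signals of the senders present and chooses an action $u\in\mathbb{R}^t$ as a Borel measurable function $\gamma$ of them. Sender 1, sender 2 and the receiver have the expected costs $J_i=\mathbb{E}\|Q_ix+R_iu\|^2$, $i=1,2,r$. The receiver's reaction $\gamma^*$ assigns to every announced policy (or pair of policies) a minimizer of $J_r$. The posterior covariance of signals $y$ is $\mathbb{E}[\hat x\hat x^\top]$ with $\hat x=\mathbb{E}[x\mid y]$. Write $M^{1/2}$ for the positive semidefinite square root, $M^\dagger$ for the Moore–Penrose inverse and $M^{\dagger 1/2}=(M^{1/2})^\dagger$. For $i=1,2$ put $V_i=\Lambda_i^\top\Lambda_i-\Lambda_i^\top Q_i-Q_i^\top\Lambda_i$ with $\Lambda_i=R_i(R_r^\top R_r)^{-1}R_r^\top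 Q_r$. *Base game.* With sender 1 alone, an equilibrium is a policy $\eta_1$ minimizing $J_1(\eta,\gamma^*(\eta))$ over all sender policies $\eta$; among policies of equal, minimal cost, sender 1 takes one whose posterior covariance has least rank. Let $\Sigma_1^*$ be the posterior covariance of such an equilibrium. *Algorithm.* For a symmetric matrix $W$ let $P^-(W)=Q(Q^\top Q)^{-1}Q^\top$, where the columns of $Q$ are a full set of linearly independent eigenvectors of $W$ for its negative eigenvalues. Put $$S_1=\Sigma_x^{1/2}P^-\big(\Sigma_x^{1/2}V_1\Sigma_x^{1/2}\big)\Sigma_x^{1/2},\qquad \Sigma^*=S_1+D^{1/2}P^-\big(D^{1/2}V_2D^{1/2}\big)D^{1/2},\quad D=\Sigma_x-S_1 .$$ *Theorem.* The algorithm can be run, and its output $\Sigma^*$ is stable for both senders: for $i=1,2$, $0\preceq\Sigma^*\preceq\Sigma_x$ and $\operatorname{Tr}(V_i\Sigma^*)=\min_{\Sigma_x\succeq S\succeq\Sigma^*}\operatorname{Tr}(V_iS)$. The base game has linear equilibria: if $\Sigma_x^{-1/2}S_1\Sigma_x^{-1/2}=U_1\Lambda_1U_1^\top$ with $U_1$ orthogonal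 and $\Lambda_1$ diagonal, then $x\mapsto Ax$ with $A^\top=\Sigma_x^{-1/2}U_1\Lambda_1$ is one. For every equilibrium $\eta_1$ of the base game, $\Sigma_1^*=S_1$; the matrix $$\tilde P_2=(\Sigma_x-\Sigma_1^*)^{\dagger 1/2}(\Sigma^*-\Sigma_1^*)(\Sigma_x-\Sigma_1^*)^{\dagger 1/2}$$ is an orthogonal projection, and $\Sigma^*=\Sigma_1^*+(\Sigma_x-\Sigma_1^*)^{1/2}\tilde P_2(\Sigma_x-\Sigma_1^*)^{1/2}$; and after commitment to $\eta_1$ the receiver has a best response to every policy of sender 2. Suppose moreover that sender 1, not knowing of sender 2, has committed to a linear equilibrium policy $\eta_1(x)=Ax$ of the base game, and that sender 2 then enters. Let $\tilde P_2=U_2^*\Lambda_2^*U_2^{*\top}$ with $U_2^*$ orthogonal and $\Lambda_2^*$ diagonal, and let $\eta_2^*(x)=Bx$ with $B^\top=(\Sigma_x-\Sigma_1^*)^{\dagger 1/2}U_2^*\Lambda_2^*$. Then, for every reaction $\gamma^*$ of the receiver, $(\eta_2^*,\gamma^*)$ is a Stackelberg equilibrium given $\eta_1$, that is, $\eta_2^*$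 minimizes $J_2(\eta_1,\eta_2,\gamma^*(\eta_1,\eta_2))$ over all Borel measurable policies $\eta_2$; and the posterior covariance of the two signals $(Ax,Bx)$ is $\Sigma^*$. -/

import Mathlib

open MeasureTheory ProbabilityTheory Matrix
open scoped ENNReal

namespace SenderGame

/-- `ℝⁿ` with its Euclidean norm. -/
abbrev E (n : ℕ) : Type := EuclideanSpace ℝ (Fin n)

/-! ### Square roots and pseudo-inverses of symmetric matrices -/

/-- The positive semidefinite square root `M^{1/2}` of a positive semidefinite matrix: the square
roots of the eigenvalues are taken in the spectral decomposition. -/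
noncomputable def psdSqrt {p : ℕ} (M : Matrix (Fin p) (Fin p) ℝ) : Matrix (Fin p) (Fin p) ℝ :=
  cfc Real.sqrt M

/-- The Moore-Penrose pseudo-inverse `M†` of a symmetric matrix: the nonzero eigenvalues are
inverted in the spectral decomposition, and the zero eigenvalues are kept (`0⁻¹ = 0`). -/
noncomputable def symPinv {p : ℕ} (M : Matrix (Fin p) (Fin p) ℝ) : Matrix (Fin p) (Fin p) ℝ :=
  cfc (fun t : ℝ => t⁻¹) M

/-! ### The game -/

/-- The state is `x ∼ N(0, Sx)`; this is its law. -/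
noncomputable def stateLaw {p : ℕ} (Sx : Matrix (Fin p) (Fin p) ℝ) : Measure (E p) :=
  multivariateGaussian 0 Sx

/-- The linear signaling policy `x ↦ A x`. -/
noncomputable def linearPolicy {p : ℕ} (A : Matrix (Fin p) (Fin p) ℝ) : E p → E p :=
  fun x => Matrix.toEuclideanLin A x

/-- Expected quadratic cost `𝔼 ‖Q x + R u‖²`, with values in `[0, ∞]`, when the receiver observes
`y x` and takes the action `u = γ (y x)`. -/
noncomputable def expectedCost {p q t : ℕ} {Y : Type*} (Sx : Matrix (Fin p) (Fin p) ℝ)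
    (Q : Matrix (Fin q) (Fin p) ℝ) (R : Matrix (Fin q) (Fin t) ℝ)
    (y : E p → Y) (γ : Y → E t) : ℝ≥0∞ :=
  ∫⁻ x, ‖Matrix.toEuclideanLin Q x + Matrix.toEuclideanLin R (γ (y x))‖ₑ ^ 2 ∂(stateLaw Sx)

/-- `γ` is a best response, among all Borel measurable policies, of a receiver with cost matrices
`Qr`, `Rr` who observes `y x`. -/
structure IsBestResponse {p q t : ℕ} {Y : Type*} [MeasurableSpace Y]
    (Sx : Matrix (Fin p) (Fin p) ℝ) (Qr : Matrix (Fin q) (Fin p) ℝ) (Rr : Matrix (Fin q) (Fin t) ℝ)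
    (y : E p → Y) (γ : Y → E t) : Prop where
  measurable : Measurable γ
  optimal : ∀ γ' : Y → E t, Measurable γ' →
    expectedCost Sx Qr Rr y γ ≤ expectedCost Sx Qr Rr y γ'

/-- `γ` is a reaction of the receiver to an announced policy of the sender that is currently
choosing: `obs η` is what the receiver observes if that sender chooses `η`, and `γ η` has to be a
best response to it, for every Borel measurable `η`. -/
def IsReceiverReaction {p q t : ℕ} {Y : Type*} [MeasurableSpace Y]
    (Sx : Matrix (Fin p) (Fin p) ℝ) (Qr : Matrix (Fin q) (Fin p) ℝ) (Rr : Matrix (Fin q) (Fin t) ℝ)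
    (obs : (E p → E p) → E p → Y) (γ : (E p → E p) → Y → E t) : Prop :=
  ∀ η : E p → E p, Measurable η → IsBestResponse Sx Qr Rr (obs η) (γ η)

/-- `(η, γ)` is a Stackelberg equilibrium between a sender with cost matrices `Q`, `R`, who leads
and may choose any Borel measurable policy, and a receiver with cost matrices `Qr`, `Rr`. -/
structure IsStackelberg {p q t : ℕ} {Y : Type*} [MeasurableSpace Y]
    (Sx : Matrix (Fin p) (Fin p) ℝ) (Q : Matrix (Fin q) (Fin p) ℝ) (R : Matrix (Fin q) (Fin t) ℝ)
    (Qr : Matrix (Fin q) (Fin p) ℝ) (Rr : Matrix (Fin q) (Fin t) ℝ)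
    (obs : (E p → E p) → E p → Y) (η : E p → E p) (γ : (E p → E p) → Y → E t) : Prop where
  measurable : Measurable η
  reaction : IsReceiverReaction Sx Qr Rr obs γ
  optimal : ∀ η' : E p → E p, Measurable η' →
    expectedCost Sx Q R (obs η) (γ η) ≤ expectedCost Sx Q R (obs η') (γ η')

/-- Observation in the base game, with one sender: its signal. -/
def obsSingle {p : ℕ} (η : E p → E p) : E p → E p := η

/-- Observation after a first sender has committed to `η₁`: the pair of signals. -/
def obsAfter {p : ℕ} (η₁ η : E p → E p) : E p → E p × E p := fun x => (η₁ x, η x)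

/-- The posterior estimate `𝔼[x | y]`. -/
noncomputable def posteriorMean {p : ℕ} {Y : Type*} [MeasurableSpace Y]
    (Sx : Matrix (Fin p) (Fin p) ℝ) (y : E p → Y) : E p → E p :=
  (stateLaw Sx)[fun x : E p => x | MeasurableSpace.comap y inferInstance]

/-- The posterior covariance `𝔼[x̂ x̂ᵀ]` with `x̂ = 𝔼[x | y]`. -/
noncomputable def posteriorCov {p : ℕ} {Y : Type*} [MeasurableSpace Y]
    (Sx : Matrix (Fin p) (Fin p) ℝ) (y : E p → Y) : Matrix (Fin p) (Fin p) ℝ :=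
  Matrix.of fun i j => ∫ x, posteriorMean Sx y x i * posteriorMean Sx y x j ∂(stateLaw Sx)

/-- Equilibrium of the base game with one sender, with the convention that among policies of equal
cost the sender takes one that reveals only what is needed: the posterior covariance has the least
rank among all equilibrium policies. -/
structure IsBaseEquilibrium {p q t : ℕ}
    (Sx : Matrix (Fin p) (Fin p) ℝ) (Q : Matrix (Fin q) (Fin p) ℝ) (R : Matrix (Fin q) (Fin t) ℝ)
    (Qr : Matrix (Fin q) (Fin p) ℝ) (Rr : Matrix (Fin q) (Fin t) ℝ)
    (η : E p → E p) (γ : (E p → E p) → E p → E t) : Prop where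
  stackelberg : IsStackelberg Sx Q R Qr Rr obsSingle η γ
  least_rank : ∀ η' : E p → E p, IsStackelberg Sx Q R Qr Rr obsSingle η' γ →
    (posteriorCov Sx η).rank ≤ (posteriorCov Sx η').rank

/-! ### The trace objectives, stability, and the algorithm -/

/-- `V = ΛᵀΛ - ΛᵀQ - QᵀΛ` with `Λ = R (RrᵀRr)⁻¹ Rrᵀ Qr`. -/
noncomputable def costMatrix {p q t : ℕ} (Q : Matrix (Fin q) (Fin p) ℝ)
    (R : Matrix (Fin q) (Fin t) ℝ) (Qr : Matrix (Fin q) (Fin p) ℝ)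
    (Rr : Matrix (Fin q) (Fin t) ℝ) : Matrix (Fin p) (Fin p) ℝ :=
  let L := R * (Rrᵀ * Rr)⁻¹ * Rrᵀ * Qr
  Lᵀ * L - Lᵀ * Q - Qᵀ * L

/-- `S` is stable for a sender with trace objective `V`: `S` attains the minimum of `Tr(V T)` over
`Sx ⪰ T ⪰ S ⪰ 0`. -/
structure IsStable {p : ℕ} (Sx V S : Matrix (Fin p) (Fin p) ℝ) : Prop where
  nonneg : S.PosSemidef
  le_prior : (Sx - S).PosSemidef
  minimal : ∀ T : Matrix (Fin p) (Fin p) ℝ, (Sx - T).PosSemidef → (T - S).PosSemidef →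
    (V * S).trace ≤ (V * T).trace

/-- The columns of `Q` are a full set of linearly independent eigenvectors of `W` for its negative
eigenvalues. -/
structure IsNegEigenbasis {p r : ℕ} (W : Matrix (Fin p) (Fin p) ℝ)
    (Q : Matrix (Fin p) (Fin r) ℝ) : Prop where
  indep : LinearIndependent ℝ (fun j : Fin r => Q.col j)
  eigen : ∀ j : Fin r, ∃ c : ℝ, c < 0 ∧ W *ᵥ Q.col j = c • Q.col j
  complete : ∀ (c : ℝ) (v : Fin p → ℝ), c < 0 → W *ᵥ v = c • v →
    v ∈ Submodule.span ℝ (Set.range fun j : Fin r => Q.col j)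

/-- One step of the algorithm, from the posterior `S` to the posterior `S'`: with
`W = (Sx - S)^{1/2} V (Sx - S)^{1/2}`, `Q` the matrix of eigenvectors of its negative eigenvalues
and `P = Q (QᵀQ)⁻¹ Qᵀ`, put `S' = S + (Sx - S)^{1/2} P (Sx - S)^{1/2}`. -/
def AlgorithmStep {p : ℕ} (Sx V S S' : Matrix (Fin p) (Fin p) ℝ) : Prop :=
  ∃ (r : ℕ) (Q : Matrix (Fin p) (Fin r) ℝ),
    IsNegEigenbasis (psdSqrt (Sx - S) * V * psdSqrt (Sx - S)) Q ∧
    S' = S + psdSqrt (Sx - S) * (Q * (Qᵀ * Q)⁻¹ * Qᵀ) * psdSqrt (Sx - S)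

/-- A run of the algorithm: a step for sender 1 from the zero posterior to `S₁`, then a step for
sender 2 from `S₁` to the output `S`. -/
def AlgorithmRun {p : ℕ} (Sx V₁ V₂ S₁ S : Matrix (Fin p) (Fin p) ℝ) : Prop :=
  AlgorithmStep Sx V₁ 0 S₁ ∧ AlgorithmStep Sx V₂ S₁ S

end SenderGame

/-!
For a receiver with reaction `u = -K x̂`, the cost of a sender is a constant plus `Tr (V Σ)`, where
`Σ` is the posterior covariance, so the game is about choosing `Σ`. Whatever the signals, `Σ` lies
between the posterior covariance `S` that the previous signals enforce and `Sx`. With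
`D = Sx - S`, writing `Σ - S = D^{1/2} X D^{1/2}` turns the constraint into `0 ⪯ X ⪯ 1` and the
objective into `Tr (W X)` with `W = D^{1/2} V D^{1/2}`. This is least at the spectral projection
`P⁻(W)`, and every minimizer `X` satisfies `P⁻(W) X = P⁻(W)`, so that `P⁻(W)` is the only one of
least rank. Linear policies attain the bound: for jointly Gaussian signals the conditional
expectation is linear regression, and a suitable factor of `P⁻(W)` gives a signal that reveals
exactly `D^{1/2} P⁻(W) D^{1/2}` beyond `S`.
-/

namespace SenderGame

open scoped MatrixOrder

/-! ### Loewner order and spectral projections -/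

section Loewner

variable {n k : Type*} [Fintype n] {A B P X : Matrix n n ℝ}

lemma trace_mul_nonneg (hA : 0 ≤ A) (hB : 0 ≤ B) : 0 ≤ (A * B).trace := by
  classical
  obtain ⟨L, rfl⟩ := CStarAlgebra.nonneg_iff_eq_star_mul_self.mp hA
  rw [Matrix.mul_assoc, trace_mul_comm]
  exact (star_right_conjugate_nonneg hB L).posSemidef.trace_nonneg

lemma mul_eq_zero_of_trace_mul_eq_zero (hA : 0 ≤ A) (hB : 0 ≤ B) (h : (A * B).trace = 0) :
    A * B = 0 := by
  classical
  obtain ⟨L, rfl⟩ := CStarAlgebra.nonneg_iff_eq_star_mul_self.mp hA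
  obtain ⟨M, rfl⟩ := CStarAlgebra.nonneg_iff_eq_star_mul_self.mp hB
  have hLM : L * star M = 0 := by
    rw [← trace_conjTranspose_mul_self_eq_zero_iff, ← h, ← star_eq_conjTranspose, star_mul,
      star_star, Matrix.mul_assoc, trace_mul_comm]
    simp only [Matrix.mul_assoc]
  rw [Matrix.mul_assoc, ← Matrix.mul_assoc L, hLM, Matrix.zero_mul, Matrix.mul_zero]

lemma mul_eq_zero_of_le (hA : 0 ≤ A) (hAB : A ≤ B) {K : Matrix n k ℝ} (hK : B * K = 0) :
    A * K = 0 := by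
  ext i j
  have hB : B *ᵥ K.col j = 0 := funext fun i ↦ congr($hK i j)
  have hle : K.col j ⬝ᵥ A *ᵥ K.col j ≤ 0 := by
    simpa [sub_mulVec, hB] using (le_iff.1 hAB).dotProduct_mulVec_nonneg (K.col j)
  have hge := hA.posSemidef.dotProduct_mulVec_nonneg (K.col j)
  exact congr_fun ((hA.posSemidef.dotProduct_mulVec_zero_iff _).1 (le_antisymm hle hge)) i

lemma eq_of_mul_eq_of_rank_le (hP : IsStarProjection P) (hX : IsSelfAdjoint X) (hPX : P * X = P)
    (hrank : X.rank ≤ P.rank) : X = P := by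
  classical
  have hXP : X * P = P := by simpa [hP.isSelfAdjoint.star_eq, hX.star_eq] using congr(star $hPX)
  have hle : LinearMap.range P.mulVecLin ≤ LinearMap.range X.mulVecLin := by
    rw [← hXP, mulVecLin_mul]
    exact LinearMap.range_comp_le_range _ _
  have hrange := Submodule.eq_of_le_of_finrank_le hle hrank
  rw [← hPX]
  refine ext_of_mulVec_single fun j ↦ ?_
  obtain ⟨v, hv⟩ : X *ᵥ Pi.single j 1 ∈ LinearMap.range P.mulVecLin := hrange ▸ ⟨_, rfl⟩
  rw [mulVecLin_apply] at hv
  rw [← mulVec_mulVec, ← hv, mulVec_mulVec, hP.isIdempotentElem.eq]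

end Loewner

section Calculus

variable {n : Type*} [Fintype n] [DecidableEq n] {M : Matrix n n ℝ}

lemma continuousOn_spectrum (M : Matrix n n ℝ) (f : ℝ → ℝ) : ContinuousOn f (spectrum ℝ M) :=
  (Matrix.finite_real_spectrum (A := M)).continuousOn f

lemma mul_cfc (hM : IsSelfAdjoint M) (f : ℝ → ℝ) : M * cfc f M = cfc (fun x ↦ x * f x) M := by
  rw [cfc_mul _ _ M (continuousOn_spectrum M _) (continuousOn_spectrum M _), cfc_id' ℝ M]

lemma cfc_mul_self_comm (hM : IsSelfAdjoint M) (f : ℝ → ℝ) : cfc f M * M = M * cfc f M := by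
  simpa only [cfc_id' ℝ M] using (cfc_commute_cfc f (fun x ↦ x) M).eq

lemma isStarProjection_cfc (M : Matrix n n ℝ) {f : ℝ → ℝ} (hf : ∀ x, f x * f x = f x) :
    IsStarProjection (cfc f M) where
  isIdempotentElem := by
    rw [IsIdempotentElem, ← cfc_mul _ _ M (continuousOn_spectrum M _) (continuousOn_spectrum M _)]
    simp only [hf]
  isSelfAdjoint := cfc_predicate _ _

lemma cfc_mulVec_eq_smul (hM : IsSelfAdjoint M) (f : ℝ → ℝ) {c : ℝ} {v : n → ℝ}
    (hv : M *ᵥ v = c • v) : cfc f M *ᵥ v = f c • v := by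
  have hfin : (spectrum ℝ M ∪ {c}).Finite := finite_real_spectrum.union (Set.finite_singleton c)
  set q := Lagrange.interpolate hfin.toFinset id f
  have hq {x} (hx : x ∈ spectrum ℝ M ∪ {c}) : q.eval x = f x :=
    Lagrange.eval_interpolate_at_node _ (Set.injOn_id _) (hfin.mem_toFinset.2 hx)
  have hcfc : cfc f M = Polynomial.aeval M q := by
    rw [← cfc_polynomial (R := ℝ) q M]
    exact cfc_congr fun x hx ↦ (hq (.inl hx)).symm
  have heval : Polynomial.aeval M q *ᵥ v = q.eval c • v := by
    simpa [Polynomial.aeval_algEquiv] using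
      Module.End.aeval_apply_of_mem_apply_eq_smul (f := toLinAlgEquiv' M) (p := q) (x := v)
        (by simpa using hv)
  rw [hcfc, heval, hq (.inr rfl)]

end Calculus

section Root

variable {p : ℕ} {M D T : Matrix (Fin p) (Fin p) ℝ}

lemma isSelfAdjoint_psdSqrt (D : Matrix (Fin p) (Fin p) ℝ) : IsSelfAdjoint (psdSqrt D) :=
  cfc_predicate _ _

lemma isSelfAdjoint_symPinv (M : Matrix (Fin p) (Fin p) ℝ) : IsSelfAdjoint (symPinv M) :=
  cfc_predicate _ _

lemma psdSqrt_mul_self (hD : 0 ≤ D) : psdSqrt D * psdSqrt D = D := by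
  have hD' : IsSelfAdjoint D := .of_nonneg hD
  rw [psdSqrt, ← cfc_mul _ _ D (continuousOn_spectrum D _) (continuousOn_spectrum D _)]
  conv_rhs => rw [← cfc_id' ℝ D]
  exact cfc_congr fun x hx ↦ Real.mul_self_sqrt (spectrum_nonneg_of_nonneg hD hx)

lemma isStarProjection_mul_symPinv (hM : IsSelfAdjoint M) : IsStarProjection (M * symPinv M) := by
  rw [symPinv, mul_cfc hM]
  exact isStarProjection_cfc M fun x ↦ by rcases eq_or_ne x 0 with rfl | hx <;> simp [*]

lemma symPinv_mul_comm (hM : IsSelfAdjoint M) : symPinv M * M = M * symPinv M :=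
  cfc_mul_self_comm hM _

lemma mul_symPinv_mul_self (hM : IsSelfAdjoint M) : M * symPinv M * M = M := by
  rw [Matrix.mul_assoc, symPinv, cfc_mul_self_comm hM, mul_cfc hM, mul_cfc hM]
  conv_rhs => rw [← cfc_id' ℝ M]
  simp only [← mul_assoc, mul_self_mul_inv]

/-- The matrix `D^{†1/2} T D^{†1/2}`, which expresses `0 ⪯ T ⪯ D` on the scale on which `D` is a
projection. -/
noncomputable def whiten (D T : Matrix (Fin p) (Fin p) ℝ) : Matrix (Fin p) (Fin p) ℝ :=
  symPinv (psdSqrt D) * T * symPinv (psdSqrt D)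

lemma psdSqrt_mul_whiten_mul_psdSqrt (hT : 0 ≤ T) (hTD : T ≤ D) :
    psdSqrt D * whiten D T * psdSqrt D = T := by
  have hH := isSelfAdjoint_psdSqrt D
  have hG := isSelfAdjoint_symPinv (psdSqrt D)
  have hker : D * (1 - symPinv (psdSqrt D) * psdSqrt D) = 0 := by
    nth_rw 1 [← psdSqrt_mul_self (hT.trans hTD)]
    rw [mul_sub, mul_one, mul_assoc, ← mul_assoc (psdSqrt D) (symPinv _),
      mul_symPinv_mul_self hH, sub_self]
  have hright : T * (symPinv (psdSqrt D) * psdSqrt D) = T := by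
    have := mul_eq_zero_of_le hT hTD hker
    rwa [mul_sub, mul_one, sub_eq_zero, eq_comm] at this
  have hleft : psdSqrt D * symPinv (psdSqrt D) * T = T := by
    simpa [hH.star_eq, hG.star_eq, (IsSelfAdjoint.of_nonneg hT).star_eq] using congr(star $hright)
  calc psdSqrt D * whiten D T * psdSqrt D
      = psdSqrt D * symPinv (psdSqrt D) * T * (symPinv (psdSqrt D) * psdSqrt D) := by
        simp only [whiten, mul_assoc]
    _ = T := by rw [hleft, hright]

lemma whiten_nonneg (hT : 0 ≤ T) : 0 ≤ whiten D T :=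
  (isSelfAdjoint_symPinv _).conjugate_nonneg hT

lemma whiten_le_one (hD : 0 ≤ D) (hTD : T ≤ D) : whiten D T ≤ 1 := by
  have hG := isSelfAdjoint_symPinv (psdSqrt D)
  have hE := isStarProjection_mul_symPinv (isSelfAdjoint_psdSqrt D)
  calc whiten D T ≤ whiten D D := hG.conjugate_le_conjugate hTD
    _ = psdSqrt D * symPinv (psdSqrt D) := by
        nth_rw 2 [← psdSqrt_mul_self hD]
        rw [whiten, ← mul_assoc, symPinv_mul_comm (isSelfAdjoint_psdSqrt D), mul_assoc,
          hE.isIdempotentElem.eq]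
    _ ≤ 1 := hE.le_one

lemma symPinv_psdSqrt_eq_inv (hD : D.PosDef) : symPinv (psdSqrt D) = (psdSqrt D)⁻¹ := by
  have hdet : IsUnit (psdSqrt D).det := by
    refine isUnit_of_mul_isUnit_left (y := (psdSqrt D).det) ?_
    rw [← det_mul, psdSqrt_mul_self hD.posSemidef.nonneg]
    exact hD.det_pos.ne'.isUnit
  refine (inv_eq_right_inv ?_).symm
  rw [← Matrix.mul_one (_ * _), ← mul_nonsing_inv _ hdet, ← Matrix.mul_assoc,
    mul_symPinv_mul_self (isSelfAdjoint_psdSqrt D)]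

end Root

section NegProj

variable {n : Type*} [Fintype n] [DecidableEq n] {W X : Matrix n n ℝ}

/-- The spectral projection `P⁻(W)` of a symmetric matrix `W` onto the span of its eigenvectors for
negative eigenvalues. Unlike `Q (QᵀQ)⁻¹ Qᵀ`, it does not refer to a choice of eigenvectors. -/
noncomputable def negProj (W : Matrix n n ℝ) : Matrix n n ℝ :=
  cfc ((Set.Iio 0).indicator 1 : ℝ → ℝ) W

lemma isStarProjection_negProj (W : Matrix n n ℝ) : IsStarProjection (negProj W) :=
  isStarProjection_cfc W fun x ↦ by by_cases hx : x ∈ Set.Iio (0 : ℝ) <;> simp [hx]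

lemma mul_negProj_nonpos (hW : IsSelfAdjoint W) : W * negProj W ≤ 0 := by
  rw [negProj, mul_cfc hW]
  exact cfc_nonpos _ _ fun x _ ↦ by
    by_cases hx : x < 0
    · simp [hx, hx.le]
    · simp [hx]

lemma mul_one_sub_negProj_nonneg (hW : IsSelfAdjoint W) : 0 ≤ W * (1 - negProj W) := by
  rw [negProj, mul_sub, mul_one, mul_cfc hW]
  nth_rw 1 [← cfc_id' ℝ W]
  rw [← cfc_sub _ _ W (continuousOn_spectrum W _) (continuousOn_spectrum W _)]
  exact cfc_nonneg fun x _ ↦ by by_cases hx : x < 0 <;> simp_all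

lemma cfc_inv_mul_self_mul_negProj (hW : IsSelfAdjoint W) :
    cfc (fun x : ℝ ↦ x⁻¹) W * (W * negProj W) = negProj W := by
  rw [negProj, mul_cfc hW, ← cfc_mul _ _ W (continuousOn_spectrum W _) (continuousOn_spectrum W _)]
  exact cfc_congr fun x _ ↦ by
    by_cases hx : x < 0
    · simp [hx, hx.ne]
    · simp [hx]

lemma negProj_mulVec_of_neg (hW : IsSelfAdjoint W) {c : ℝ} (hc : c < 0) {v : n → ℝ}
    (hv : W *ᵥ v = c • v) : negProj W *ᵥ v = v := by
  simpa [negProj, hc] using cfc_mulVec_eq_smul hW ((Set.Iio 0).indicator 1) hv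

lemma negProj_mulVec_of_nonneg (hW : IsSelfAdjoint W) {c : ℝ} (hc : 0 ≤ c) {v : n → ℝ}
    (hv : W *ᵥ v = c • v) : negProj W *ᵥ v = 0 := by
  simpa [negProj, hc] using cfc_mulVec_eq_smul hW ((Set.Iio 0).indicator 1) hv

lemma trace_mul_sub_trace_mul_negProj (W X : Matrix n n ℝ) :
    (W * X).trace - (W * negProj W).trace =
      (W * (1 - negProj W) * X).trace + (-(W * negProj W) * (1 - X)).trace := by
  rw [← trace_add, ← trace_sub]
  congr 1
  noncomm_ring

lemma trace_mul_negProj_le (hW : IsSelfAdjoint W) (hX : 0 ≤ X) (hX1 : X ≤ 1) :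
    (W * negProj W).trace ≤ (W * X).trace := by
  have hpos := trace_mul_nonneg (mul_one_sub_negProj_nonneg hW) hX
  have hneg := trace_mul_nonneg (neg_nonneg.2 (mul_negProj_nonpos hW)) (sub_nonneg.2 hX1)
  linarith [trace_mul_sub_trace_mul_negProj W X]

lemma negProj_mul_eq_of_trace_le (hW : IsSelfAdjoint W) (hX : 0 ≤ X) (hX1 : X ≤ 1)
    (h : (W * X).trace ≤ (W * negProj W).trace) : negProj W * X = negProj W := by
  have hpos := trace_mul_nonneg (mul_one_sub_negProj_nonneg hW) hX
  have hneg := trace_mul_nonneg (neg_nonneg.2 (mul_negProj_nonpos hW)) (sub_nonneg.2 hX1)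
  have hzero : -(W * negProj W) * (1 - X) = 0 :=
    mul_eq_zero_of_trace_mul_eq_zero (neg_nonneg.2 (mul_negProj_nonpos hW)) (sub_nonneg.2 hX1)
      (by linarith [trace_mul_sub_trace_mul_negProj W X])
  rw [neg_mul, neg_eq_zero, mul_sub, mul_one, sub_eq_zero] at hzero
  rw [← cfc_inv_mul_self_mul_negProj hW, mul_assoc, ← hzero]

end NegProj

section NegEigenbasis

variable {p r : ℕ} {W : Matrix (Fin p) (Fin p) ℝ} {Q : Matrix (Fin p) (Fin r) ℝ}

lemma exists_isNegEigenbasis (W : Matrix (Fin p) (Fin p) ℝ) :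
    ∃ (r : ℕ) (Q : Matrix (Fin p) (Fin r) ℝ), IsNegEigenbasis W Q := by
  obtain ⟨b, hb, hspan, hindep⟩ :=
    exists_linearIndependent ℝ {v : Fin p → ℝ | ∃ c : ℝ, c < 0 ∧ W *ᵥ v = c • v}
  have := hindep.finite
  let e := (Finite.equivFin b).symm
  refine ⟨Nat.card b, (of fun j ↦ (e j : Fin p → ℝ))ᵀ, hindep.comp e e.injective,
    fun j ↦ hb (e j).2, fun c v hc hv ↦ ?_⟩
  have hrange : (Set.range fun j ↦ (e j : Fin p → ℝ)) = b := by
    rw [← Function.comp_def, e.surjective.range_comp, Subtype.range_coe]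
  exact (congrArg (v ∈ Submodule.span ℝ ·) hrange).mpr
    (hspan ▸ Submodule.subset_span ⟨c, hc, hv⟩)

lemma mulVec_eq_self_of_mem_span_col (hQ : IsUnit (Qᵀ * Q).det) {v : Fin p → ℝ}
    (hv : v ∈ Submodule.span ℝ (Set.range Q.col)) : (Q * (Qᵀ * Q)⁻¹ * Qᵀ) *ᵥ v = v := by
  rw [← range_mulVecLin] at hv
  obtain ⟨w, rfl⟩ := hv
  rw [mulVecLin_apply, mulVec_mulVec, Matrix.mul_assoc, Matrix.mul_assoc, nonsing_inv_mul _ hQ,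
    Matrix.mul_one]

lemma negProj_eq_of_isNegEigenbasis (hW : IsSelfAdjoint W) (hQ : IsNegEigenbasis W Q) :
    Q * (Qᵀ * Q)⁻¹ * Qᵀ = negProj W := by
  have hdet : IsUnit (Qᵀ * Q).det := by
    have := PosDef.conjTranspose_mul_self Q (mulVec_injective_iff.2 hQ.indep)
    exact this.det_pos.ne'.isUnit
  have hPQ : negProj W * Q = Q := by
    ext i j
    obtain ⟨c, hc, hv⟩ := hQ.eigen j
    exact congr_fun (negProj_mulVec_of_neg hW hc hv) i
  have hQP : Q * (Qᵀ * Q)⁻¹ * Qᵀ * negProj W = negProj W := by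
    have hW' : W.IsHermitian := hW
    refine (toEuclideanLin (𝕜 := ℝ)).injective (hW'.eigenvectorBasis.toBasis.ext fun i ↦ ?_)
    have hv := hW'.mulVec_eigenvectorBasis i
    rw [OrthonormalBasis.coe_toBasis, toLpLin_apply, toLpLin_apply, ← mulVec_mulVec]
    rcases lt_or_ge (hW'.eigenvalues i) 0 with hc | hc
    · rw [negProj_mulVec_of_neg hW hc hv,
        mulVec_eq_self_of_mem_span_col hdet (hQ.complete _ _ hc hv)]
    · rw [negProj_mulVec_of_nonneg hW hc hv, mulVec_zero]
  have hsymm : IsSelfAdjoint (Q * (Qᵀ * Q)⁻¹ * Qᵀ) := by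
    simp [IsSelfAdjoint, star_eq_conjTranspose, transpose_nonsing_inv, Matrix.mul_assoc]
  calc Q * (Qᵀ * Q)⁻¹ * Qᵀ = negProj W * (Q * (Qᵀ * Q)⁻¹ * Qᵀ) := by
        simp only [← Matrix.mul_assoc, hPQ]
    _ = star (Q * (Qᵀ * Q)⁻¹ * Qᵀ * negProj W) := by
        rw [star_mul, hsymm.star_eq, (isStarProjection_negProj W).isSelfAdjoint.star_eq]
    _ = negProj W := by rw [hQP, (isStarProjection_negProj W).isSelfAdjoint.star_eq]

end NegEigenbasis

/-! ### The algorithm -/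

section Algorithm

variable {p : ℕ} {Sx V D T S S' : Matrix (Fin p) (Fin p) ℝ}

/-- The projection `P⁻(D^{1/2} V D^{1/2})` chosen by a step of the algorithm for a sender with
objective `V`, when the uncertainty left to be revealed is `D`. -/
noncomputable def stepProj (V D : Matrix (Fin p) (Fin p) ℝ) : Matrix (Fin p) (Fin p) ℝ :=
  negProj (psdSqrt D * V * psdSqrt D)

/-- The covariance `D^{1/2} P⁻(D^{1/2} V D^{1/2}) D^{1/2}` that a step of the algorithm adds to the
posterior covariance, when the uncertainty left to be revealed is `D`. -/
noncomputable def stepIncrement (V D : Matrix (Fin p) (Fin p) ℝ) : Matrix (Fin p) (Fin p) ℝ :=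
  psdSqrt D * stepProj V D * psdSqrt D

lemma isStarProjection_stepProj (V D : Matrix (Fin p) (Fin p) ℝ) :
    IsStarProjection (stepProj V D) :=
  isStarProjection_negProj _

lemma isSelfAdjoint_psdSqrt_conj (hV : IsSelfAdjoint V) (D : Matrix (Fin p) (Fin p) ℝ) :
    IsSelfAdjoint (psdSqrt D * V * psdSqrt D) :=
  hV.conjugate_self (isSelfAdjoint_psdSqrt D)

lemma stepProj_mul_psdSqrt_mul_symPinv (hV : IsSelfAdjoint V) (D : Matrix (Fin p) (Fin p) ℝ) :
    stepProj V D * (psdSqrt D * symPinv (psdSqrt D)) = stepProj V D := by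
  have hH := isSelfAdjoint_psdSqrt D
  have hW := isSelfAdjoint_psdSqrt_conj hV D
  have hWE : psdSqrt D * V * psdSqrt D * (psdSqrt D * symPinv (psdSqrt D)) =
      psdSqrt D * V * psdSqrt D := by
    rw [← symPinv_mul_comm hH, mul_assoc _ (psdSqrt D), ← mul_assoc (psdSqrt D),
      mul_symPinv_mul_self hH]
  rw [stepProj]
  generalize psdSqrt D * V * psdSqrt D = W at hW hWE ⊢
  rw [← cfc_inv_mul_self_mul_negProj hW, negProj, ← cfc_mul_self_comm hW, mul_assoc, mul_assoc, hWE]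

lemma psdSqrt_mul_symPinv_mul_stepProj (hV : IsSelfAdjoint V) (D : Matrix (Fin p) (Fin p) ℝ) :
    psdSqrt D * symPinv (psdSqrt D) * stepProj V D = stepProj V D := by
  simpa [(isStarProjection_stepProj V D).isSelfAdjoint.star_eq,
    (isStarProjection_mul_symPinv (isSelfAdjoint_psdSqrt D)).isSelfAdjoint.star_eq,
    star_mul _ (psdSqrt D * _)] using congr(star $(stepProj_mul_psdSqrt_mul_symPinv hV D))

lemma whiten_stepIncrement (hV : IsSelfAdjoint V) (D : Matrix (Fin p) (Fin p) ℝ) :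
    whiten D (stepIncrement V D) = stepProj V D :=
  calc whiten D (stepIncrement V D)
      = symPinv (psdSqrt D) * psdSqrt D * (stepProj V D * (psdSqrt D * symPinv (psdSqrt D))) := by
        simp only [whiten, stepIncrement, mul_assoc]
    _ = stepProj V D := by
        rw [stepProj_mul_psdSqrt_mul_symPinv hV, symPinv_mul_comm (isSelfAdjoint_psdSqrt D),
          psdSqrt_mul_symPinv_mul_stepProj hV]

lemma stepIncrement_nonneg (V D : Matrix (Fin p) (Fin p) ℝ) : 0 ≤ stepIncrement V D :=
  (isSelfAdjoint_psdSqrt D).conjugate_nonneg (isStarProjection_stepProj V D).nonneg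

lemma stepIncrement_le (V : Matrix (Fin p) (Fin p) ℝ) (hD : 0 ≤ D) : stepIncrement V D ≤ D :=
  calc stepIncrement V D ≤ psdSqrt D * 1 * psdSqrt D :=
        (isSelfAdjoint_psdSqrt D).conjugate_le_conjugate (isStarProjection_stepProj V D).le_one
    _ = D := by rw [mul_one, psdSqrt_mul_self hD]

lemma trace_mul_stepIncrement (V D : Matrix (Fin p) (Fin p) ℝ) :
    (V * stepIncrement V D).trace = (psdSqrt D * V * psdSqrt D * stepProj V D).trace := by
  rw [stepIncrement, ← mul_assoc, ← mul_assoc, trace_mul_comm]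
  simp only [mul_assoc]

lemma trace_mul_eq_trace_mul_whiten (V : Matrix (Fin p) (Fin p) ℝ) (hT : 0 ≤ T) (hTD : T ≤ D) :
    (V * T).trace = (psdSqrt D * V * psdSqrt D * whiten D T).trace := by
  nth_rw 1 [← psdSqrt_mul_whiten_mul_psdSqrt hT hTD]
  rw [← mul_assoc, ← mul_assoc, trace_mul_comm]
  simp only [mul_assoc]

lemma trace_mul_stepIncrement_le (hV : IsSelfAdjoint V) (hT : 0 ≤ T) (hTD : T ≤ D) :
    (V * stepIncrement V D).trace ≤ (V * T).trace := by
  rw [trace_mul_stepIncrement, trace_mul_eq_trace_mul_whiten V hT hTD]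
  exact trace_mul_negProj_le (isSelfAdjoint_psdSqrt_conj hV D) (whiten_nonneg hT)
    (whiten_le_one (hT.trans hTD) hTD)

lemma stepProj_mul_whiten (hV : IsSelfAdjoint V) (hT : 0 ≤ T) (hTD : T ≤ D)
    (hmin : (V * T).trace ≤ (V * stepIncrement V D).trace) :
    stepProj V D * whiten D T = stepProj V D := by
  rw [trace_mul_stepIncrement, trace_mul_eq_trace_mul_whiten V hT hTD] at hmin
  exact negProj_mul_eq_of_trace_le (isSelfAdjoint_psdSqrt_conj hV D) (whiten_nonneg hT)
    (whiten_le_one (hT.trans hTD) hTD) hmin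

lemma rank_whiten_le (D T : Matrix (Fin p) (Fin p) ℝ) : (whiten D T).rank ≤ T.rank :=
  (rank_mul_le_left _ _).trans (rank_mul_le_right _ _)

lemma rank_stepIncrement_le_rank_stepProj (V D : Matrix (Fin p) (Fin p) ℝ) :
    (stepIncrement V D).rank ≤ (stepProj V D).rank :=
  (rank_mul_le_left _ _).trans (rank_mul_le_right _ _)

lemma rank_stepIncrement_le (hV : IsSelfAdjoint V) (hT : 0 ≤ T) (hTD : T ≤ D)
    (hmin : (V * T).trace ≤ (V * stepIncrement V D).trace) :
    (stepIncrement V D).rank ≤ T.rank :=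
  calc (stepIncrement V D).rank ≤ (stepProj V D).rank := rank_stepIncrement_le_rank_stepProj V D
    _ = (stepProj V D * whiten D T).rank := by rw [stepProj_mul_whiten hV hT hTD hmin]
    _ ≤ (whiten D T).rank := rank_mul_le_right _ _
    _ ≤ T.rank := rank_whiten_le D T

lemma eq_stepIncrement_of_rank_le (hV : IsSelfAdjoint V) (hT : 0 ≤ T) (hTD : T ≤ D)
    (hmin : (V * T).trace ≤ (V * stepIncrement V D).trace)
    (hrank : T.rank ≤ (stepIncrement V D).rank) : T = stepIncrement V D := by
  have hwhiten : whiten D T = stepProj V D :=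
    eq_of_mul_eq_of_rank_le (isStarProjection_stepProj V D) (.of_nonneg (whiten_nonneg hT))
      (stepProj_mul_whiten hV hT hTD hmin)
      ((rank_whiten_le D T).trans (hrank.trans (rank_stepIncrement_le_rank_stepProj V D)))
  rw [stepIncrement, ← hwhiten, psdSqrt_mul_whiten_mul_psdSqrt hT hTD]

lemma algorithmStep_iff (hV : IsSelfAdjoint V) :
    AlgorithmStep Sx V S S' ↔ S' = S + stepIncrement V (Sx - S) := by
  have hW := isSelfAdjoint_psdSqrt_conj hV (Sx - S)
  constructor
  · rintro ⟨r, Q, hQ, rfl⟩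
    rw [negProj_eq_of_isNegEigenbasis hW hQ, stepIncrement, stepProj]
  · rintro rfl
    obtain ⟨r, Q, hQ⟩ := exists_isNegEigenbasis (psdSqrt (Sx - S) * V * psdSqrt (Sx - S))
    exact ⟨r, Q, hQ, by rw [negProj_eq_of_isNegEigenbasis hW hQ, stepIncrement, stepProj]⟩

lemma trace_mul_add_stepIncrement_le (hV : IsSelfAdjoint V) (hST : S ≤ T) (hT : T ≤ Sx) :
    (V * (S + stepIncrement V (Sx - S))).trace ≤ (V * T).trace := by
  have hdiff := trace_mul_stepIncrement_le hV (sub_nonneg.2 hST) (sub_le_sub_right hT S)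
  rw [mul_sub, trace_sub] at hdiff
  rw [mul_add, trace_add]
  linarith

lemma add_stepIncrement_le (V : Matrix (Fin p) (Fin p) ℝ) (hS : S ≤ Sx) :
    S + stepIncrement V (Sx - S) ≤ Sx :=
  le_sub_iff_add_le'.1 (stepIncrement_le V (sub_nonneg.2 hS))

lemma isStable_add_stepIncrement (hV : IsSelfAdjoint V) (hS : 0 ≤ S) (hSx : S ≤ Sx) :
    IsStable Sx V (S + stepIncrement V (Sx - S)) where
  nonneg := (add_nonneg hS (stepIncrement_nonneg _ _)).posSemidef
  le_prior := le_iff.1 (add_stepIncrement_le V hSx)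
  minimal _ hT hST := trace_mul_add_stepIncrement_le hV
    ((le_add_of_nonneg_right (stepIncrement_nonneg V _)).trans (le_iff.2 hST)) (le_iff.2 hT)

lemma IsStable.mono (h : IsStable Sx V S) (hSS' : S ≤ S') (hS' : S' ≤ Sx) : IsStable Sx V S' where
  nonneg := (h.nonneg.nonneg.trans hSS').posSemidef
  le_prior := le_iff.1 hS'
  minimal T hT hS'T := by
    have hle : S + (T - S') ≤ Sx :=
      calc S + (T - S') ≤ S' + (T - S') := by gcongr
        _ = T := add_sub_cancel S' T
        _ ≤ Sx := le_iff.2 hT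
    have hmin := h.minimal (S + (T - S')) (le_iff.1 hle) (by simpa using hS'T)
    rw [mul_add, mul_sub, trace_add, trace_sub] at hmin
    linarith

lemma algorithmRun_iff {V' : Matrix (Fin p) (Fin p) ℝ} (hV : IsSelfAdjoint V)
    (hV' : IsSelfAdjoint V') :
    AlgorithmRun Sx V V' S S' ↔ S = stepIncrement V Sx ∧ S' = S + stepIncrement V' (Sx - S) := by
  rw [AlgorithmRun, algorithmStep_iff hV, algorithmStep_iff hV', zero_add, sub_zero]

lemma isStable_stepIncrement (hV : IsSelfAdjoint V) (hSx : 0 ≤ Sx) :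
    IsStable Sx V (stepIncrement V Sx) := by
  simpa only [zero_add, sub_zero] using isStable_add_stepIncrement hV le_rfl hSx

end Algorithm

/-! ### Conditional expectation and second moments -/

section ConditionalExpectation

variable {Ω H : Type*} {m₀ m : MeasurableSpace Ω} {μ : Measure[m₀] Ω}
  [NormedAddCommGroup H] [InnerProductSpace ℝ H] {f g : Ω → H}

lemma integrable_inner_of_memLp_two (hf : MemLp f 2 μ) (hg : MemLp g 2 μ) :
    Integrable (fun ω ↦ inner ℝ (f ω) (g ω)) μ :=
  (L2.integrable_inner (𝕜 := ℝ) hf.toLp hg.toLp).congr <| by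
    filter_upwards [hf.coeFn_toLp, hg.coeFn_toLp] with ω hfω hgω
    rw [hfω, hgω]

variable [IsFiniteMeasure μ] [CompleteSpace H]

lemma integral_inner_condExp (hm : m ≤ m₀) (hf : MemLp f 2 μ) (hg : MemLp g 2 μ)
    (hgm : AEStronglyMeasurable[m] g μ) :
    ∫ ω, inner ℝ (g ω) ((μ[f | m]) ω) ∂μ = ∫ ω, inner ℝ (g ω) (f ω) ∂μ := by
  have hpull := condExp_bilin_of_aestronglyMeasurable_left (innerSL ℝ) hgm
    (integrable_inner_of_memLp_two hg hf) (hf.integrable one_le_two)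
  exact (integral_congr_ae hpull.symm).trans (integral_condExp hm)

lemma integral_norm_add_sq_eq_condExp (hm : m ≤ m₀) (hf : MemLp f 2 μ) (hg : MemLp g 2 μ)
    (hgm : AEStronglyMeasurable[m] g μ) :
    ∫ ω, ‖f ω + g ω‖ ^ 2 ∂μ =
      ∫ ω, ‖f ω - (μ[f | m]) ω‖ ^ 2 ∂μ + ∫ ω, ‖(μ[f | m]) ω + g ω‖ ^ 2 ∂μ := by
  have hc : MemLp (μ[f | m]) 2 μ := hf.condExp one_le_two
  have hcg : MemLp (fun ω ↦ (μ[f | m]) ω + g ω) 2 μ := hc.add hg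
  have hfc : MemLp (fun ω ↦ f ω - (μ[f | m]) ω) 2 μ := hf.sub hc
  have hcgm : AEStronglyMeasurable[m] (fun ω ↦ (μ[f | m]) ω + g ω) μ :=
    stronglyMeasurable_condExp.aestronglyMeasurable.add hgm
  have hcross : ∫ ω, inner ℝ ((μ[f | m]) ω + g ω) (f ω - (μ[f | m]) ω) ∂μ = 0 := by
    simp only [inner_sub_right]
    rw [integral_sub (integrable_inner_of_memLp_two hcg hf) (integrable_inner_of_memLp_two hcg hc),
      integral_inner_condExp hm hf hcg hcgm, sub_self]
  have hsplit (ω : Ω) : ‖f ω + g ω‖ ^ 2 = ‖f ω - (μ[f | m]) ω‖ ^ 2 +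
      2 * inner ℝ ((μ[f | m]) ω + g ω) (f ω - (μ[f | m]) ω) + ‖(μ[f | m]) ω + g ω‖ ^ 2 := by
    rw [real_inner_comm, ← norm_add_sq_real]
    congr 2
    abel
  have hcross_int := (integrable_inner_of_memLp_two hcg hfc).const_mul 2
  have hsum : Integrable (fun ω ↦ ‖f ω - (μ[f | m]) ω‖ ^ 2 +
      2 * inner ℝ ((μ[f | m]) ω + g ω) (f ω - (μ[f | m]) ω)) μ :=
    hfc.norm.integrable_sq.add hcross_int
  simp only [hsplit]
  rw [integral_add hsum hcg.norm.integrable_sq,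
    integral_add hfc.norm.integrable_sq hcross_int, integral_const_mul, hcross, mul_zero, add_zero]

end ConditionalExpectation

section SecondMoment

variable {Ω ι κ : Type*} {m₀ : MeasurableSpace Ω} {μ : Measure Ω}
  {f : Ω → EuclideanSpace ℝ ι}

/-- The matrix `𝔼[f fᵀ]` of second moments of a random vector; for `f` centred, its covariance. -/
noncomputable def secondMoment (μ : Measure Ω) (f : Ω → EuclideanSpace ℝ ι) : Matrix ι ι ℝ :=
  of fun i j ↦ ∫ ω, f ω i * f ω j ∂μ

lemma secondMoment_congr_ae {g : Ω → EuclideanSpace ℝ ι} (h : f =ᵐ[μ] g) :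
    secondMoment μ f = secondMoment μ g := by
  ext i j
  exact integral_congr_ae (by filter_upwards [h] with ω hω; rw [hω])

variable [Fintype ι]

lemma integrable_eval_mul_eval (hf : MemLp f 2 μ) (i j : ι) :
    Integrable (fun ω ↦ f ω i * f ω j) μ :=
  (hf.eval_piLp i).integrable_mul (hf.eval_piLp j)

lemma secondMoment_nonneg (hf : MemLp f 2 μ) : 0 ≤ secondMoment μ f := by
  have hgram : secondMoment μ f = gram ℝ fun i ↦ (hf.eval_piLp i).toLp := by
    ext i j
    rw [gram_apply, L2.inner_def]
    refine integral_congr_ae ?_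
    filter_upwards [(hf.eval_piLp i).coeFn_toLp, (hf.eval_piLp j).coeFn_toLp] with ω hi hj
    rw [hi, hj, real_inner_comm]
    rfl
  exact hgram ▸ (posSemidef_gram ℝ _).nonneg

lemma memLp_toEuclideanLin [Fintype κ] [DecidableEq ι] {s : ℝ≥0∞}
    (hf : MemLp f s μ) (A : Matrix κ ι ℝ) :
    MemLp (fun ω ↦ toEuclideanLin A (f ω)) s μ :=
  (toEuclideanLin A).toContinuousLinearMap.comp_memLp' hf

lemma secondMoment_toEuclideanLin [DecidableEq ι] (hf : MemLp f 2 μ) (A : Matrix κ ι ℝ) :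
    secondMoment μ (fun ω ↦ toEuclideanLin A (f ω)) = A * secondMoment μ f * Aᵀ := by
  ext i j
  have hexpand (ω : Ω) : toEuclideanLin A (f ω) i * toEuclideanLin A (f ω) j =
      ∑ l, ∑ k, A i k * A j l * (f ω k * f ω l) := by
    simp only [ofLp_toLpLin, toLin'_apply, mulVec, dotProduct, Finset.sum_mul_sum]
    rw [Finset.sum_comm]
    exact Finset.sum_congr rfl fun l _ ↦ Finset.sum_congr rfl fun k _ ↦ by ring
  have hint (k l : ι) := (integrable_eval_mul_eval hf k l).const_mul (A i k * A j l)
  simp only [secondMoment, of_apply, hexpand, mul_apply, transpose_apply, Finset.sum_mul]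
  rw [integral_finsetSum _ fun l _ ↦ integrable_finsetSum _ fun k _ ↦ hint k l]
  refine Finset.sum_congr rfl fun l _ ↦ ?_
  rw [integral_finsetSum _ fun k _ ↦ hint k l]
  refine Finset.sum_congr rfl fun k _ ↦ ?_
  rw [integral_const_mul]
  ring

lemma integral_norm_sq_eq_trace (hf : MemLp f 2 μ) :
    ∫ ω, ‖f ω‖ ^ 2 ∂μ = (secondMoment μ f).trace := by
  simp only [EuclideanSpace.real_norm_sq_eq]
  simp only [pow_two]
  exact integral_finsetSum _ fun i _ ↦ integrable_eval_mul_eval hf i i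

lemma integral_norm_toEuclideanLin_sq [Fintype κ] [DecidableEq ι]
    (hf : MemLp f 2 μ) (A : Matrix κ ι ℝ) :
    ∫ ω, ‖toEuclideanLin A (f ω)‖ ^ 2 ∂μ = (Aᵀ * A * secondMoment μ f).trace := by
  rw [integral_norm_sq_eq_trace (memLp_toEuclideanLin hf A), secondMoment_toEuclideanLin hf A,
    trace_mul_comm, Matrix.mul_assoc]

variable {m m' : MeasurableSpace Ω}

lemma condExp_toEuclideanLin [Fintype κ] [DecidableEq ι] (hf : Integrable f μ) (A : Matrix κ ι ℝ) :
    μ[fun ω ↦ toEuclideanLin A (f ω) | m] =ᵐ[μ] fun ω ↦ toEuclideanLin A ((μ[f | m]) ω) :=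
  ((toEuclideanLin A).toContinuousLinearMap.comp_condExp_comm hf).symm

variable [IsFiniteMeasure μ]

lemma integral_eval_mul_eval_condExp (hm : m ≤ m₀) (hf : MemLp f 2 μ) (i j : ι) :
    ∫ ω, f ω i * (μ[f | m]) ω j ∂μ = ∫ ω, (μ[f | m]) ω i * (μ[f | m]) ω j ∂μ := by
  have hmeas : AEStronglyMeasurable[m] (fun ω ↦ (μ[f | m]) ω j) μ :=
    ((EuclideanSpace.proj (𝕜 := ℝ) j).continuous.comp_stronglyMeasurable
      stronglyMeasurable_condExp).aestronglyMeasurable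
  have heval : (fun ω ↦ (μ[f | m]) ω i) =ᵐ[μ] μ[fun ω ↦ f ω i | m] :=
    (EuclideanSpace.proj i).comp_condExp_comm (hf.integrable one_le_two)
  have hpull := integral_inner_condExp hm (hf.eval_piLp i)
    ((hf.condExp one_le_two).eval_piLp j) hmeas
  simp only [RCLike.inner_apply, conj_trivial] at hpull
  rw [← hpull]
  exact integral_congr_ae (by filter_upwards [heval] with ω hω; rw [hω])

lemma integral_sub_condExp_eval_mul_eval_condExp (hm : m ≤ m₀) (hf : MemLp f 2 μ) (i j : ι) :
    ∫ ω, (f ω - (μ[f | m]) ω) i * (μ[f | m]) ω j ∂μ = 0 := by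
  have hc : MemLp (μ[f | m]) 2 μ := hf.condExp one_le_two
  have hfc : Integrable (fun ω ↦ f ω i * (μ[f | m]) ω j) μ :=
    (hf.eval_piLp i).integrable_mul (hc.eval_piLp j)
  simp only [PiLp.sub_apply, sub_mul]
  rw [integral_sub hfc (integrable_eval_mul_eval hc i j), integral_eval_mul_eval_condExp hm hf,
    sub_self]

lemma secondMoment_sub_condExp (hm : m ≤ m₀) (hf : MemLp f 2 μ) :
    secondMoment μ (fun ω ↦ f ω - (μ[f | m]) ω) =
      secondMoment μ f - secondMoment μ (μ[f | m]) := by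
  ext i j
  set c := μ[f | m]
  have hc : MemLp c 2 μ := hf.condExp one_le_two
  have hexpand (ω : Ω) : (f ω - c ω) i * (f ω - c ω) j = f ω i * f ω j - c ω i * c ω j -
      ((f ω - c ω) i * c ω j + (f ω - c ω) j * c ω i) := by
    simp only [PiLp.sub_apply]
    ring
  have hff := integrable_eval_mul_eval hf i j
  have hcc := integrable_eval_mul_eval hc i j
  have hres (i j : ι) : Integrable (fun ω ↦ (f ω - c ω) i * c ω j) μ :=
    ((hf.sub hc).eval_piLp i).integrable_mul (hc.eval_piLp j)
  calc ∫ ω, (f ω - c ω) i * (f ω - c ω) j ∂μ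
      = ∫ ω, (f ω i * f ω j - c ω i * c ω j) ∂μ -
          ∫ ω, ((f ω - c ω) i * c ω j + (f ω - c ω) j * c ω i) ∂μ := by
        simp only [hexpand]
        exact integral_sub (hff.sub hcc) ((hres i j).add (hres j i))
    _ = ∫ ω, f ω i * f ω j ∂μ - ∫ ω, c ω i * c ω j ∂μ := by
        rw [integral_add (hres i j) (hres j i),
          integral_sub_condExp_eval_mul_eval_condExp hm hf,
          integral_sub_condExp_eval_mul_eval_condExp hm hf, add_zero, sub_zero,
          integral_sub hff hcc]

lemma secondMoment_condExp_le (hm : m ≤ m₀) (hf : MemLp f 2 μ) :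
    secondMoment μ (μ[f | m]) ≤ secondMoment μ f := by
  rw [← sub_nonneg, ← secondMoment_sub_condExp hm hf]
  exact secondMoment_nonneg (hf.sub (hf.condExp one_le_two))

lemma secondMoment_condExp_mono (hmm' : m ≤ m') (hm' : m' ≤ m₀) (hf : MemLp f 2 μ) :
    secondMoment μ (μ[f | m]) ≤ secondMoment μ (μ[f | m']) := by
  rw [← secondMoment_congr_ae (condExp_condExp_of_le hmm' hm')]
  exact secondMoment_condExp_le (hmm'.trans hm') (hf.condExp one_le_two)

end SecondMoment

/-! ### The receiver -/

section EuclideanLin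

variable {ι κ τ : Type*} [Fintype κ] [Fintype τ] [DecidableEq κ] [DecidableEq τ]

lemma toEuclideanLin_mul_apply (A : Matrix ι κ ℝ) (B : Matrix κ τ ℝ) (x : EuclideanSpace ℝ τ) :
    toEuclideanLin (A * B) x = toEuclideanLin A (toEuclideanLin B x) := by
  rw [toLpLin_mul_same, LinearMap.comp_apply]

lemma inner_toEuclideanLin_right [Fintype ι] [DecidableEq ι] (A : Matrix ι κ ℝ)
    (v : EuclideanSpace ℝ ι) (x : EuclideanSpace ℝ κ) :
    inner ℝ v (toEuclideanLin A x) = inner ℝ (toEuclideanLin Aᵀ v) x := by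
  rw [← conjTranspose_eq_transpose_of_trivial, toEuclideanLin_conjTranspose_eq_adjoint,
    LinearMap.adjoint_inner_left]

lemma norm_add_sq_of_transpose_mul_eq_zero [Fintype ι] {M : Matrix ι κ ℝ} {N : Matrix ι τ ℝ}
    (h : Nᵀ * M = 0) (x : EuclideanSpace ℝ κ) (u : EuclideanSpace ℝ τ) :
    ‖toEuclideanLin M x + toEuclideanLin N u‖ ^ 2 =
      ‖toEuclideanLin M x‖ ^ 2 + ‖toEuclideanLin N u‖ ^ 2 := by
  classical
  have horth : inner ℝ (toEuclideanLin M x) (toEuclideanLin N u) = 0 := by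
    rw [inner_toEuclideanLin_right, ← toEuclideanLin_mul_apply, h, map_zero, LinearMap.zero_apply,
      inner_zero_left]
  rw [norm_add_sq_real, horth, mul_zero, add_zero]

end EuclideanLin

section Posterior

variable {p : ℕ} {Sx : Matrix (Fin p) (Fin p) ℝ}

instance isGaussian_stateLaw : IsGaussian (stateLaw Sx) := by
  unfold stateLaw
  infer_instance

lemma memLp_state : MemLp (fun x : E p ↦ x) 2 (stateLaw Sx) :=
  IsGaussian.memLp_two_id

lemma integrable_state : Integrable (fun x : E p ↦ x) (stateLaw Sx) :=
  memLp_state.integrable one_le_two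

lemma integral_toEuclideanLin_state {ι : Type*} [Fintype ι] (A : Matrix ι (Fin p) ℝ) :
    ∫ x, toEuclideanLin A x ∂(stateLaw Sx) = 0 := by
  have hcomm := (toEuclideanLin A).toContinuousLinearMap.integral_comp_comm
    (integrable_state (Sx := Sx))
  rwa [stateLaw, integral_id_multivariateGaussian, map_zero] at hcomm

lemma secondMoment_state (hSx : 0 ≤ Sx) : secondMoment (stateLaw Sx) (fun x ↦ x) = Sx := by
  ext i j
  have hmean : ∫ x : E p, x i ∂(stateLaw Sx) = 0 := by
    have hcomm := (EuclideanSpace.proj (𝕜 := ℝ) i).integral_comp_comm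
      (integrable_state (Sx := Sx))
    rwa [stateLaw, integral_id_multivariateGaussian, map_zero] at hcomm
  have hcov := covariance_eq_sub ((memLp_state (Sx := Sx)).eval_piLp i)
    ((memLp_state (Sx := Sx)).eval_piLp j)
  rw [hmean, zero_mul, sub_zero] at hcov
  exact hcov.symm.trans (covariance_eval_multivariateGaussian hSx.posSemidef i j)

variable {Y Z : Type*} [mY : MeasurableSpace Y] [mZ : MeasurableSpace Z]

lemma memLp_posteriorMean (y : E p → Y) : MemLp (posteriorMean Sx y) 2 (stateLaw Sx) :=
  memLp_state.condExp one_le_two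

lemma posteriorCov_nonneg (y : E p → Y) : 0 ≤ posteriorCov Sx y :=
  secondMoment_nonneg (memLp_posteriorMean y)

lemma posteriorCov_le (hSx : 0 ≤ Sx) {y : E p → Y} (hy : Measurable y) :
    posteriorCov Sx y ≤ Sx :=
  (secondMoment_condExp_le hy.comap_le memLp_state).trans_eq (secondMoment_state hSx)

lemma secondMoment_sub_posteriorMean (hSx : 0 ≤ Sx) {y : E p → Y} (hy : Measurable y) :
    secondMoment (stateLaw Sx) (fun x ↦ x - posteriorMean Sx y x) = Sx - posteriorCov Sx y :=
  (secondMoment_sub_condExp hy.comap_le memLp_state).trans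
    (congrArg (· - posteriorCov Sx y) (secondMoment_state hSx))

lemma posteriorCov_mono {y : E p → Y} {z : E p → Z} (hz : Measurable z)
    (hyz : mY.comap y ≤ mZ.comap z) : posteriorCov Sx y ≤ posteriorCov Sx z :=
  secondMoment_condExp_mono hyz hz.comap_le memLp_state

end Posterior

section Receiver

variable {p q t : ℕ} {Sx : Matrix (Fin p) (Fin p) ℝ} {Y : Type*}
  {Q Qr : Matrix (Fin q) (Fin p) ℝ} {R Rr : Matrix (Fin q) (Fin t) ℝ} {y : E p → Y} {γ : Y → E t}

lemma memLp_cost {u : E p → E t} (hu : MemLp u 2 (stateLaw Sx)) :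
    MemLp (fun x ↦ toEuclideanLin Q x + toEuclideanLin R (u x)) 2 (stateLaw Sx) :=
  (memLp_toEuclideanLin memLp_state Q).add (memLp_toEuclideanLin hu R)

lemma expectedCost_eq_ofReal (hγ : MemLp (fun x ↦ γ (y x)) 2 (stateLaw Sx)) :
    expectedCost Sx Q R y γ = ENNReal.ofReal
      (∫ x, ‖toEuclideanLin Q x + toEuclideanLin R (γ (y x))‖ ^ 2 ∂(stateLaw Sx)) := by
  rw [ofReal_integral_eq_lintegral_ofReal (memLp_cost hγ).norm.integrable_sq
    (.of_forall fun _ ↦ by positivity)]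
  refine lintegral_congr fun x ↦ ?_
  rw [← ofReal_norm, ENNReal.ofReal_pow (norm_nonneg _)]

/-- The gain `K = (RrᵀRr)⁻¹ Rrᵀ Qr` of the receiver, whose best response to the posterior mean
`x̂` is `u = -K x̂`. -/
noncomputable def gain (Qr : Matrix (Fin q) (Fin p) ℝ) (Rr : Matrix (Fin q) (Fin t) ℝ) :
    Matrix (Fin t) (Fin p) ℝ :=
  (Rrᵀ * Rr)⁻¹ * Rrᵀ * Qr

lemma transpose_mul_sub_mul_gain (hRr : IsUnit (Rrᵀ * Rr)) :
    Rrᵀ * (Qr - Rr * gain Qr Rr) = 0 := by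
  rw [Matrix.mul_sub, sub_eq_zero, gain, ← Matrix.mul_assoc, Matrix.mul_assoc _ Rrᵀ,
    mul_nonsing_inv_cancel_left _ _ ((isUnit_iff_isUnit_det _).1 hRr)]

lemma leftInverse_toEuclideanLin (hRr : IsUnit (Rrᵀ * Rr)) :
    Function.LeftInverse (toEuclideanLin ((Rrᵀ * Rr)⁻¹ * Rrᵀ)) (toEuclideanLin Rr) := fun u ↦ by
  rw [← toEuclideanLin_mul_apply, Matrix.mul_assoc,
    nonsing_inv_mul _ ((isUnit_iff_isUnit_det _).1 hRr), toLpLin_one, LinearMap.id_apply]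

variable [mY : MeasurableSpace Y]

lemma memLp_of_expectedCost_lt_top (hRr : IsUnit (Rrᵀ * Rr)) (hy : Measurable y)
    (hγ : Measurable γ) (h : expectedCost Sx Qr Rr y γ < ∞) :
    MemLp (fun x ↦ γ (y x)) 2 (stateLaw Sx) := by
  have hmeas (N : Matrix (Fin q) (Fin t) ℝ) : Measurable fun x ↦ toEuclideanLin N (γ (y x)) :=
    (toEuclideanLin N).continuous_of_finiteDimensional.measurable.comp (hγ.comp hy)
  have hcost : MemLp (fun x ↦ toEuclideanLin Qr x + toEuclideanLin Rr (γ (y x))) 2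
      (stateLaw Sx) := by
    refine ⟨((toEuclideanLin Qr).continuous_of_finiteDimensional.measurable.add
      (hmeas Rr)).aestronglyMeasurable, ?_⟩
    rw [eLpNorm_lt_top_iff_lintegral_rpow_enorm_lt_top two_ne_zero ENNReal.ofNat_ne_top]
    simpa only [expectedCost, ENNReal.toReal_ofNat, ENNReal.rpow_ofNat] using h
  have hRu : MemLp (fun x ↦ toEuclideanLin Rr (γ (y x))) 2 (stateLaw Sx) :=
    (hcost.sub (memLp_toEuclideanLin memLp_state Qr)).ae_eq
      (.of_forall fun x ↦ add_sub_cancel_left _ _)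
  simpa only [leftInverse_toEuclideanLin hRr _] using
    memLp_toEuclideanLin hRu ((Rrᵀ * Rr)⁻¹ * Rrᵀ)

lemma stronglyMeasurable_gain_posteriorMean (y : E p → Y) :
    StronglyMeasurable[mY.comap y]
      fun x ↦ -toEuclideanLin (gain Qr Rr) (posteriorMean Sx y x) :=
  ((toEuclideanLin (gain Qr Rr)).continuous_of_finiteDimensional.comp_stronglyMeasurable
    stronglyMeasurable_condExp).neg

lemma memLp_gain_posteriorMean (y : E p → Y) :
    MemLp (fun x ↦ -toEuclideanLin (gain Qr Rr) (posteriorMean Sx y x)) 2 (stateLaw Sx) :=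
  (memLp_toEuclideanLin (memLp_posteriorMean y) _).neg

lemma exists_measurable_eq_gain_posteriorMean (y : E p → Y) :
    ∃ γ : Y → E t, Measurable γ ∧
      ∀ x, γ (y x) = -toEuclideanLin (gain Qr Rr) (posteriorMean Sx y x) := by
  obtain ⟨γ, hγ, hcomp⟩ := (stronglyMeasurable_gain_posteriorMean
    (Sx := Sx) (Qr := Qr) (Rr := Rr) y).exists_eq_measurable_comp
  exact ⟨γ, hγ.measurable, fun x ↦ (congrFun hcomp x).symm⟩

-- `c` is the cost that remains when the state is observed, plus the cost of having to estimate it.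
lemma exists_integral_norm_sq_eq_add (hRr : IsUnit (Rrᵀ * Rr)) (hy : Measurable y) :
    ∃ c : ℝ, ∀ γ : Y → E t, Measurable γ → MemLp (fun x ↦ γ (y x)) 2 (stateLaw Sx) →
      ∫ x, ‖toEuclideanLin Qr x + toEuclideanLin Rr (γ (y x))‖ ^ 2 ∂(stateLaw Sx) =
        c + ∫ x, ‖toEuclideanLin Rr
          (toEuclideanLin (gain Qr Rr) (posteriorMean Sx y x) + γ (y x))‖ ^ 2 ∂(stateLaw Sx) := by
  set K := gain Qr Rr with hK
  have hRK := memLp_toEuclideanLin (memLp_state (Sx := Sx)) (Rr * K)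
  refine ⟨∫ x, ‖toEuclideanLin (Qr - Rr * K) x‖ ^ 2 ∂(stateLaw Sx) +
    ∫ x, ‖toEuclideanLin (Rr * K) x -
      ((stateLaw Sx)[fun x ↦ toEuclideanLin (Rr * K) x | mY.comap y]) x‖ ^ 2 ∂(stateLaw Sx),
    fun γ hγ hu ↦ ?_⟩
  have hRu := memLp_toEuclideanLin hu Rr
  have hRum : AEStronglyMeasurable[mY.comap y] (fun x ↦ toEuclideanLin Rr (γ (y x)))
      (stateLaw Sx) :=
    ((toEuclideanLin Rr).continuous_of_finiteDimensional.measurable.comp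
      (hγ.comp (comap_measurable y))).stronglyMeasurable.aestronglyMeasurable
  have hpyth (x : E p) : ‖toEuclideanLin Qr x + toEuclideanLin Rr (γ (y x))‖ ^ 2 =
      ‖toEuclideanLin (Qr - Rr * K) x‖ ^ 2 +
        ‖toEuclideanLin (Rr * K) x + toEuclideanLin Rr (γ (y x))‖ ^ 2 := by
    rw [toEuclideanLin_mul_apply, ← map_add,
      ← norm_add_sq_of_transpose_mul_eq_zero (transpose_mul_sub_mul_gain hRr), map_add,
      ← toEuclideanLin_mul_apply, map_sub, LinearMap.sub_apply, ← hK, ← add_assoc,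
      sub_add_cancel]
  have hRKu : Integrable (fun x ↦ ‖toEuclideanLin (Rr * K) x + toEuclideanLin Rr (γ (y x))‖ ^ 2)
      (stateLaw Sx) := (hRK.add hRu).norm.integrable_sq
  simp only [hpyth]
  rw [integral_add (memLp_toEuclideanLin memLp_state _).norm.integrable_sq hRKu,
    integral_norm_add_sq_eq_condExp hy.comap_le hRK hRu hRum, add_assoc]
  congr 2
  refine integral_congr_ae ?_
  filter_upwards [condExp_toEuclideanLin (m := mY.comap y) integrable_state (Rr * K)] with x hx
  rw [hx, map_add, toEuclideanLin_mul_apply]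
  rfl

lemma isBestResponse_of_ae_eq (hRr : IsUnit (Rrᵀ * Rr)) (hy : Measurable y) (hγ : Measurable γ)
    (h : (fun x ↦ γ (y x)) =ᵐ[stateLaw Sx]
      fun x ↦ -toEuclideanLin (gain Qr Rr) (posteriorMean Sx y x)) :
    IsBestResponse Sx Qr Rr y γ := by
  refine ⟨hγ, fun γ' hγ' ↦ ?_⟩
  obtain hfin | htop := lt_or_ge (expectedCost Sx Qr Rr y γ') ∞
  · have hu := (memLp_gain_posteriorMean y).ae_eq h.symm
    have hu' := memLp_of_expectedCost_lt_top hRr hy hγ' hfin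
    obtain ⟨c, hc⟩ := exists_integral_norm_sq_eq_add (Sx := Sx) (Qr := Qr) hRr hy
    rw [expectedCost_eq_ofReal hu, expectedCost_eq_ofReal hu', hc γ hγ hu, hc γ' hγ' hu']
    have hzero : ∫ x, ‖toEuclideanLin Rr (toEuclideanLin (gain Qr Rr) (posteriorMean Sx y x) +
        γ (y x))‖ ^ 2 ∂(stateLaw Sx) = 0 := by
      refine integral_eq_zero_of_ae ?_
      filter_upwards [h] with x hx
      simp [hx]
    rw [hzero]
    exact ENNReal.ofReal_le_ofReal
      (add_le_add_right (integral_nonneg fun x ↦ by positivity) c)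
  · exact le_top.trans htop

lemma IsBestResponse.ae_eq (hRr : IsUnit (Rrᵀ * Rr)) (hy : Measurable y)
    (hγ : IsBestResponse Sx Qr Rr y γ) :
    (fun x ↦ γ (y x)) =ᵐ[stateLaw Sx]
      fun x ↦ -toEuclideanLin (gain Qr Rr) (posteriorMean Sx y x) := by
  obtain ⟨γ₀, hγ₀, hγ₀_eq⟩ :=
    exists_measurable_eq_gain_posteriorMean (Sx := Sx) (Qr := Qr) (Rr := Rr) y
  have hu₀ : MemLp (fun x ↦ γ₀ (y x)) 2 (stateLaw Sx) := by
    simp only [hγ₀_eq]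
    exact memLp_gain_posteriorMean y
  have hle := hγ.optimal γ₀ hγ₀
  have hfin : expectedCost Sx Qr Rr y γ₀ < ∞ := by
    rw [expectedCost_eq_ofReal hu₀]
    exact ENNReal.ofReal_lt_top
  have hu := memLp_of_expectedCost_lt_top hRr hy hγ.measurable (hle.trans_lt hfin)
  obtain ⟨c, hc⟩ := exists_integral_norm_sq_eq_add (Sx := Sx) (Qr := Qr) hRr hy
  rw [expectedCost_eq_ofReal hu, expectedCost_eq_ofReal hu₀,
    ENNReal.ofReal_le_ofReal_iff (integral_nonneg fun x ↦ by positivity),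
    hc γ hγ.measurable hu, hc γ₀ hγ₀ hu₀, add_le_add_iff_left] at hle
  simp only [hγ₀_eq, add_neg_cancel, map_zero, norm_zero, ne_eq, OfNat.ofNat_ne_zero,
    not_false_eq_true, zero_pow, integral_zero] at hle
  have hexcess : MemLp (fun x ↦ toEuclideanLin Rr
      (toEuclideanLin (gain Qr Rr) (posteriorMean Sx y x) + γ (y x))) 2 (stateLaw Sx) :=
    memLp_toEuclideanLin ((memLp_toEuclideanLin (memLp_posteriorMean y) (gain Qr Rr)).add hu) Rr
  have hzero := (integral_eq_zero_iff_of_nonneg (fun x ↦ by positivity)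
    hexcess.norm.integrable_sq).1 (hle.antisymm (integral_nonneg fun x ↦ by positivity))
  filter_upwards [hzero] with x hx
  have hker := norm_eq_zero.1 (sq_eq_zero_iff.1 hx)
  exact eq_neg_of_add_eq_zero_right
    ((leftInverse_toEuclideanLin hRr).injective (hker.trans (map_zero _).symm))

lemma exists_isReceiverReaction (hRr : IsUnit (Rrᵀ * Rr)) {obs : (E p → E p) → E p → Y}
    (hobs : ∀ η, Measurable η → Measurable (obs η)) :
    ∃ γ : (E p → E p) → Y → E t, IsReceiverReaction Sx Qr Rr obs γ := by
  choose γ hγ hγ_eq using fun η ↦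
    exists_measurable_eq_gain_posteriorMean (Sx := Sx) (Qr := Qr) (Rr := Rr) (obs η)
  exact ⟨γ, fun η hη ↦
    isBestResponse_of_ae_eq hRr (hobs η hη) (hγ η) (.of_forall (hγ_eq η))⟩

lemma costMatrix_eq (Q : Matrix (Fin q) (Fin p) ℝ) (R : Matrix (Fin q) (Fin t) ℝ)
    (Qr : Matrix (Fin q) (Fin p) ℝ) (Rr : Matrix (Fin q) (Fin t) ℝ) :
    costMatrix Q R Qr Rr = (Q - R * gain Qr Rr)ᵀ * (Q - R * gain Qr Rr) - Qᵀ * Q := by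
  have hL : R * (Rrᵀ * Rr)⁻¹ * Rrᵀ * Qr = R * gain Qr Rr := by
    simp only [gain, Matrix.mul_assoc]
  simp only [costMatrix, hL, transpose_sub, Matrix.sub_mul, Matrix.mul_sub]
  abel

lemma isSelfAdjoint_costMatrix : IsSelfAdjoint (costMatrix Q R Qr Rr) := by
  rw [costMatrix_eq]
  exact (isHermitian_conjTranspose_mul_self _).isSelfAdjoint.sub
    (isHermitian_conjTranspose_mul_self _).isSelfAdjoint

lemma integral_norm_sq_eq_of_ae_eq_gain (hSx : 0 ≤ Sx) (hy : Measurable y)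
    (h : (fun x ↦ γ (y x)) =ᵐ[stateLaw Sx]
      fun x ↦ -toEuclideanLin (gain Qr Rr) (posteriorMean Sx y x)) :
    ∫ x, ‖toEuclideanLin Q x + toEuclideanLin R (γ (y x))‖ ^ 2 ∂(stateLaw Sx) =
      (Qᵀ * Q * Sx).trace + (costMatrix Q R Qr Rr * posteriorCov Sx y).trace := by
  have hQ := memLp_toEuclideanLin (memLp_state (Sx := Sx)) Q
  have hmean := memLp_posteriorMean (Sx := Sx) y
  have hres : MemLp (fun x ↦ x - posteriorMean Sx y x) 2 (stateLaw Sx) := memLp_state.sub hmean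
  have hRu := memLp_toEuclideanLin (memLp_gain_posteriorMean (Sx := Sx) (Qr := Qr) (Rr := Rr) y) R
  have hRum : AEStronglyMeasurable[mY.comap y] (fun x ↦ toEuclideanLin R
      (-toEuclideanLin (gain Qr Rr) (posteriorMean Sx y x))) (stateLaw Sx) :=
    ((toEuclideanLin R).continuous_of_finiteDimensional.comp_stronglyMeasurable
      (stronglyMeasurable_gain_posteriorMean y)).aestronglyMeasurable
  have hcond := condExp_toEuclideanLin (m := mY.comap y) (integrable_state (Sx := Sx)) Q
  calc ∫ x, ‖toEuclideanLin Q x + toEuclideanLin R (γ (y x))‖ ^ 2 ∂(stateLaw Sx)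
      = ∫ x, ‖toEuclideanLin Q x + toEuclideanLin R
          (-toEuclideanLin (gain Qr Rr) (posteriorMean Sx y x))‖ ^ 2 ∂(stateLaw Sx) :=
        integral_congr_ae (by filter_upwards [h] with x hx; rw [hx])
    _ = ∫ x, ‖toEuclideanLin Q (x - posteriorMean Sx y x)‖ ^ 2 ∂(stateLaw Sx) +
          ∫ x, ‖toEuclideanLin (Q - R * gain Qr Rr) (posteriorMean Sx y x)‖ ^ 2
            ∂(stateLaw Sx) := by
        rw [integral_norm_add_sq_eq_condExp hy.comap_le hQ hRu hRum]
        congr 1 <;> refine integral_congr_ae ?_ <;> filter_upwards [hcond] with x hx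
        · rw [hx, map_sub]
          rfl
        · rw [hx, map_neg, map_sub, LinearMap.sub_apply, toEuclideanLin_mul_apply, sub_eq_add_neg]
          rfl
    _ = (Qᵀ * Q * (Sx - posteriorCov Sx y)).trace +
          ((Q - R * gain Qr Rr)ᵀ * (Q - R * gain Qr Rr) * posteriorCov Sx y).trace := by
        rw [integral_norm_toEuclideanLin_sq hres, integral_norm_toEuclideanLin_sq hmean,
          secondMoment_sub_posteriorMean hSx hy]
        rfl
    _ = (Qᵀ * Q * Sx).trace + (costMatrix Q R Qr Rr * posteriorCov Sx y).trace := by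
        rw [costMatrix_eq, Matrix.mul_sub, Matrix.sub_mul, trace_sub, trace_sub]
        ring

lemma IsBestResponse.expectedCost_le_iff {Z : Type*} [MeasurableSpace Z] {z : E p → Z}
    {γ' : Z → E t} (hSx : 0 ≤ Sx) (hRr : IsUnit (Rrᵀ * Rr)) (hy : Measurable y)
    (hz : Measurable z) (hγ : IsBestResponse Sx Qr Rr y γ) (hγ' : IsBestResponse Sx Qr Rr z γ') :
    expectedCost Sx Q R y γ ≤ expectedCost Sx Q R z γ' ↔
      (costMatrix Q R Qr Rr * posteriorCov Sx y).trace ≤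
        (costMatrix Q R Qr Rr * posteriorCov Sx z).trace := by
  have h := hγ.ae_eq hRr hy
  have h' := hγ'.ae_eq hRr hz
  rw [expectedCost_eq_ofReal ((memLp_gain_posteriorMean y).ae_eq h.symm),
    expectedCost_eq_ofReal ((memLp_gain_posteriorMean z).ae_eq h'.symm),
    ENNReal.ofReal_le_ofReal_iff (integral_nonneg fun x ↦ by positivity),
    integral_norm_sq_eq_of_ae_eq_gain hSx hy h, integral_norm_sq_eq_of_ae_eq_gain hSx hz h',
    add_le_add_iff_left]

lemma isStackelberg_iff (hSx : 0 ≤ Sx) (hRr : IsUnit (Rrᵀ * Rr))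
    {obs : (E p → E p) → E p → Y} (hobs : ∀ η, Measurable η → Measurable (obs η))
    {η : E p → E p} (hη : Measurable η) {γ : (E p → E p) → Y → E t}
    (hγ : IsReceiverReaction Sx Qr Rr obs γ) :
    IsStackelberg Sx Q R Qr Rr obs η γ ↔ ∀ η', Measurable η' →
      (costMatrix Q R Qr Rr * posteriorCov Sx (obs η)).trace ≤
        (costMatrix Q R Qr Rr * posteriorCov Sx (obs η')).trace := by
  have hcost (η' : E p → E p) (hη' : Measurable η') :=
    (hγ η hη).expectedCost_le_iff (Q := Q) (R := R) hSx hRr (hobs η hη) (hobs η' hη') (hγ η' hη')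
  exact ⟨fun h η' hη' ↦ (hcost η' hη').1 (h.optimal η' hη'),
    fun h ↦ ⟨hη, hγ, fun η' hη' ↦ (hcost η' hη').2 (h η' hη')⟩⟩

end Receiver

/-! ### Linear signals and equilibria -/

section LinearSignals

variable {p : ℕ} {Sx : Matrix (Fin p) (Fin p) ℝ} {ι : Type*}

lemma measurable_toEuclideanLin [Finite ι] (A : Matrix ι (Fin p) ℝ) :
    Measurable fun x : E p ↦ toEuclideanLin A x := by
  cases nonempty_fintype ι
  exact (toEuclideanLin A).continuous_of_finiteDimensional.measurable

lemma indepFun_toEuclideanLin [Finite ι] {κ : Type*} [Finite κ] (hSx : 0 ≤ Sx)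
    {N : Matrix κ (Fin p) ℝ} {A : Matrix ι (Fin p) ℝ} (h : N * Sx * Aᵀ = 0) :
    IndepFun (fun x : E p ↦ toEuclideanLin N x) (fun x ↦ toEuclideanLin A x) (stateLaw Sx) := by
  cases nonempty_fintype ι
  cases nonempty_fintype κ
  classical
  have hlaw : HasGaussianLaw (fun x : E p ↦ (toEuclideanLin N x, toEuclideanLin A x))
      (stateLaw Sx) :=
    (IsGaussian.hasGaussianLaw_id (μ := stateLaw Sx)).map_fun
      ((toEuclideanLin N).toContinuousLinearMap.prod (toEuclideanLin A).toContinuousLinearMap)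
  refine hlaw.indepFun_of_covariance_inner fun v w ↦ ?_
  simp only [inner_toEuclideanLin_right]
  rw [← covarianceBilin_apply_eq_cov IsGaussian.memLp_two_id, stateLaw,
    covarianceBilin_multivariateGaussian hSx.posSemidef]
  simp only [ofLp_toLpLin, toLin'_apply]
  rw [mulVec_transpose, ← dotProduct_mulVec, mulVec_mulVec, mulVec_mulVec, h, zero_mulVec,
    dotProduct_zero]

variable [Fintype ι]

lemma condExp_toEuclideanLin_mul (A : Matrix ι (Fin p) ℝ) (G : Matrix (Fin p) ι ℝ) :
    (stateLaw Sx)[fun x ↦ toEuclideanLin (G * A) x |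
      MeasurableSpace.comap (fun x ↦ toEuclideanLin A x) inferInstance] =
        fun x ↦ toEuclideanLin (G * A) x := by
  classical
  refine condExp_of_stronglyMeasurable (measurable_toEuclideanLin A).comap_le ?_
    ((memLp_toEuclideanLin memLp_state _).integrable one_le_two)
  simp only [toEuclideanLin_mul_apply]
  exact ((toEuclideanLin G).continuous_of_finiteDimensional.measurable.comp
    (comap_measurable _)).stronglyMeasurable

-- The hypothesis is the normal equation: the error `x - G A x` is uncorrelated with `A x`, hence
-- independent of it, both being jointly Gaussian.
lemma posteriorMean_toEuclideanLin (hSx : 0 ≤ Sx) {A : Matrix ι (Fin p) ℝ}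
    {G : Matrix (Fin p) ι ℝ} (h : (1 - G * A) * Sx * Aᵀ = 0) :
    posteriorMean Sx (fun x ↦ toEuclideanLin A x) =ᵐ[stateLaw Sx]
      fun x ↦ toEuclideanLin (G * A) x := by
  have hint (N : Matrix (Fin p) (Fin p) ℝ) :
      Integrable (fun x ↦ toEuclideanLin N x) (stateLaw Sx) :=
    (memLp_toEuclideanLin memLp_state N).integrable one_le_two
  have hresidual := condExp_indep_eq (measurable_toEuclideanLin (1 - G * A)).comap_le
    (measurable_toEuclideanLin A).comap_le (comap_measurable _).stronglyMeasurable
    (indepFun_toEuclideanLin hSx h)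
  have hsplit : (fun x : E p ↦ x) =
      (fun x ↦ toEuclideanLin (1 - G * A) x) + fun x ↦ toEuclideanLin (G * A) x := by
    ext1 x
    rw [Pi.add_apply, ← LinearMap.add_apply, ← map_add, sub_add_cancel, toLpLin_one,
      LinearMap.id_apply]
  have hadd := condExp_add (hint (1 - G * A)) (hint (G * A))
    (MeasurableSpace.comap (fun x ↦ toEuclideanLin A x) inferInstance)
  rw [posteriorMean, hsplit]
  filter_upwards [hadd, hresidual] with x hx hrx
  rw [hx, Pi.add_apply, hrx, condExp_toEuclideanLin_mul, integral_toEuclideanLin_state, zero_add]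

lemma posteriorCov_toEuclideanLin (hSx : 0 ≤ Sx) {A : Matrix ι (Fin p) ℝ}
    {G : Matrix (Fin p) ι ℝ} (h : (1 - G * A) * Sx * Aᵀ = 0) :
    posteriorCov Sx (fun x ↦ toEuclideanLin A x) = G * A * Sx := by
  have hcov : posteriorCov Sx (fun x ↦ toEuclideanLin A x) = G * A * Sx * (G * A)ᵀ := by
    rw [← secondMoment_state hSx, ← secondMoment_toEuclideanLin memLp_state,
      secondMoment_state hSx]
    exact secondMoment_congr_ae (posteriorMean_toEuclideanLin hSx h)
  have horth : Sx * (G * A)ᵀ = G * A * Sx * (G * A)ᵀ := by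
    rw [← sub_eq_zero, transpose_mul, ← Matrix.mul_assoc, ← Matrix.mul_assoc, ← Matrix.sub_mul]
    rw [Matrix.sub_mul, Matrix.sub_mul, Matrix.one_mul] at h
    rw [h, Matrix.zero_mul]
  have hSxT : Sxᵀ = Sx := hSx.posSemidef.isHermitian
  have hcovT : (posteriorCov Sx fun x ↦ toEuclideanLin A x)ᵀ =
      posteriorCov Sx fun x ↦ toEuclideanLin A x :=
    (posteriorCov_nonneg _).posSemidef.isHermitian
  rw [← hcovT, hcov, ← horth, transpose_mul, transpose_transpose, hSxT]

lemma exists_one_sub_mul_mul_mul_transpose_eq_zero {n : ℕ} (hSx : 0 ≤ Sx)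
    (A : Matrix (Fin n) (Fin p) ℝ) :
    ∃ G : Matrix (Fin p) (Fin n) ℝ, (1 - G * A) * Sx * Aᵀ = 0 := by
  set H := psdSqrt Sx
  have hH : Hᵀ = H := isSelfAdjoint_psdSqrt Sx
  set N := A * Sx * Aᵀ with hN
  have hNH : (H * Aᵀ)ᴴ * (H * Aᵀ) = N := by
    rw [hN, ← psdSqrt_mul_self hSx]
    simp only [conjTranspose_eq_transpose_of_trivial, transpose_mul, transpose_transpose, hH,
      Matrix.mul_assoc, H]
  have hNadj : IsSelfAdjoint N := hNH ▸ (isHermitian_conjTranspose_mul_self _).isSelfAdjoint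
  have hNzero : N * (1 - symPinv N * N) = 0 := by
    rw [mul_sub, mul_one, ← mul_assoc, mul_symPinv_mul_self hNadj, sub_self]
  have hHzero : H * Aᵀ * (1 - symPinv N * N) = 0 :=
    (conjTranspose_mul_self_mul_eq_zero _ _).1 (hNH ▸ hNzero)
  refine ⟨Sx * Aᵀ * symPinv N, ?_⟩
  calc (1 - Sx * Aᵀ * symPinv N * A) * Sx * Aᵀ
      = Sx * Aᵀ * (1 - symPinv N * N) := by
        simp only [hN, Matrix.sub_mul, Matrix.mul_sub, Matrix.one_mul, Matrix.mul_one,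
          Matrix.mul_assoc]
    _ = H * (H * Aᵀ * (1 - symPinv N * N)) := by
        rw [← psdSqrt_mul_self hSx]
        simp only [Matrix.mul_assoc, H]
    _ = 0 := by rw [hHzero, Matrix.mul_zero]

lemma posteriorMean_measurableEquiv {Y Z : Type*} [MeasurableSpace Y] [mZ : MeasurableSpace Z]
    (e : Y ≃ᵐ Z) (y : E p → Y) :
    posteriorMean Sx (fun x ↦ e (y x)) = posteriorMean Sx y := by
  have hcomap : mZ.comap (fun x ↦ e (y x)) = MeasurableSpace.comap y inferInstance := by
    rw [← Function.comp_def, ← MeasurableSpace.comap_comp, e.measurableEmbedding.comap_eq]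
  rw [posteriorMean, hcomap, posteriorMean]

lemma measurable_linearPolicy (A : Matrix (Fin p) (Fin p) ℝ) : Measurable (linearPolicy A) :=
  measurable_toEuclideanLin A

lemma measurable_obsAfter {η₁ η : E p → E p} (hη₁ : Measurable η₁) (hη : Measurable η) :
    Measurable (obsAfter η₁ η) :=
  hη₁.prodMk hη

lemma posteriorCov_obsAfter_linearPolicy_eq_fromRows (A B : Matrix (Fin p) (Fin p) ℝ) :
    posteriorCov Sx (obsAfter (linearPolicy A) (linearPolicy B)) =
      posteriorCov Sx fun x ↦ toEuclideanLin (fromRows A B) x := by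
  have hmean := posteriorMean_measurableEquiv (Sx := Sx)
    (EuclideanSpace.sumEquivProd (𝕜 := ℝ)).toHomeomorph.toMeasurableEquiv
    fun x ↦ toEuclideanLin (fromRows A B) x
  exact congrArg (secondMoment (stateLaw Sx)) hmean

lemma le_posteriorCov_obsAfter {η₁ η : E p → E p} (hη₁ : Measurable η₁) (hη : Measurable η) :
    posteriorCov Sx η₁ ≤ posteriorCov Sx (obsAfter η₁ η) := by
  refine posteriorCov_mono (measurable_obsAfter hη₁ hη) ?_
  exact (measurable_fst.comp (comap_measurable (obsAfter η₁ η))).comap_le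

lemma posteriorCov_obsAfter_linearPolicy (hSx : 0 ≤ Sx) {A B K : Matrix (Fin p) (Fin p) ℝ}
    (h : (1 - K * B) * (Sx - posteriorCov Sx (linearPolicy A)) * Bᵀ = 0) :
    posteriorCov Sx (obsAfter (linearPolicy A) (linearPolicy B)) =
      posteriorCov Sx (linearPolicy A) + K * B * (Sx - posteriorCov Sx (linearPolicy A)) := by
  obtain ⟨G, hG⟩ := exists_one_sub_mul_mul_mul_transpose_eq_zero hSx A
  have hC : posteriorCov Sx (linearPolicy A) = G * A * Sx := posteriorCov_toEuclideanLin hSx hG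
  rw [hC] at h ⊢
  -- Estimate from `A x` first, then correct by the innovation: `G A x + K (B x - B G A x)`.
  set F := fromCols (G - K * B * G) K with hF
  have hgain : F * fromRows A B = G * A + K * B * (1 - G * A) := by
    rw [hF, fromCols_mul_fromRows]
    noncomm_ring
  have hres : 1 - F * fromRows A B = (1 - K * B) * (1 - G * A) := by
    rw [hgain]
    noncomm_ring
  have horth : (1 - F * fromRows A B) * Sx * (fromRows A B)ᵀ = 0 := by
    have hA : (1 - K * B) * (1 - G * A) * Sx * Aᵀ = 0 := by
      rw [mul_assoc, mul_assoc, ← mul_assoc _ Sx, hG, mul_zero]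
    have hB : (1 - K * B) * (1 - G * A) * Sx * Bᵀ = 0 := by
      rw [mul_assoc (1 - K * B), sub_mul 1 (G * A), one_mul, h]
    rw [hres, transpose_fromRows, mul_fromCols, hA, hB, fromCols_zero]
  rw [posteriorCov_obsAfter_linearPolicy_eq_fromRows, posteriorCov_toEuclideanLin hSx horth, hgain]
  noncomm_ring

end LinearSignals

section Equilibrium

variable {p q t : ℕ} {Sx V D B U : Matrix (Fin p) (Fin p) ℝ} {l : Fin p → ℝ}
  {Q Qr : Matrix (Fin q) (Fin p) ℝ} {R Rr : Matrix (Fin q) (Fin t) ℝ}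

lemma exists_gain_of_transpose_eq (hV : IsSelfAdjoint V) (hD : 0 ≤ D)
    (hU : U ∈ orthogonalGroup (Fin p) ℝ) (hP : stepProj V D = U * diagonal l * Uᵀ)
    (hB : Bᵀ = symPinv (psdSqrt D) * U * diagonal l) :
    ∃ K, K * B * D = stepIncrement V D ∧ (1 - K * B) * D * Bᵀ = 0 := by
  set H := psdSqrt D
  set G := symPinv H
  set P := stepProj V D
  have hHG : G * H = H * G := symPinv_mul_comm (isSelfAdjoint_psdSqrt D)
  have hHH : H * H = D := psdSqrt_mul_self hD
  have hPHG : P * (H * G) = P := stepProj_mul_psdSqrt_mul_symPinv hV D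
  have hHGP : H * G * P = P := psdSqrt_mul_symPinv_mul_stepProj hV D
  have hPP : P * P = P := (isStarProjection_stepProj V D).isIdempotentElem
  have hGT : Gᵀ = G := isSelfAdjoint_symPinv H
  have hPU : P * U = U * diagonal l := by
    rw [hP, mul_assoc, (mem_orthogonalGroup_iff' _ _).1 hU, mul_one]
  have hUB : U * B = P * G := by
    rw [← transpose_transpose B, hB, transpose_mul, transpose_mul, hGT, diagonal_transpose, hP]
    simp only [mul_assoc]
  have hKBD : H * U * B * D = H * P * H := by
    rw [mul_assoc H, hUB, ← hHH, ← mul_assoc, mul_assoc H, mul_assoc P, hHG, hPHG]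
  refine ⟨H * U, hKBD, ?_⟩
  have hDB : D * Bᵀ = H * P * U := by
    rw [hB, mul_assoc G, ← hPU, ← hHH]
    nth_rw 2 [← hHGP]
    simp only [mul_assoc]
  have hKBDB : H * U * B * D * Bᵀ = H * P * U := by
    calc H * U * B * D * Bᵀ = H * (P * (H * G)) * (P * U) := by
          rw [hKBD, hB, mul_assoc G, ← hPU]
          simp only [mul_assoc]
      _ = H * P * U := by rw [hPHG, ← mul_assoc, mul_assoc H, hPP]
  rw [sub_mul, sub_mul, one_mul, hDB, hKBDB, sub_self]

lemma posteriorCov_linearPolicy_eq_stepIncrement (hSx : 0 ≤ Sx) (hV : IsSelfAdjoint V)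
    (hU : U ∈ orthogonalGroup (Fin p) ℝ) (hP : stepProj V Sx = U * diagonal l * Uᵀ)
    (hB : Bᵀ = symPinv (psdSqrt Sx) * U * diagonal l) :
    posteriorCov Sx (linearPolicy B) = stepIncrement V Sx := by
  obtain ⟨K, hK, horth⟩ := exists_gain_of_transpose_eq hV hSx hU hP hB
  exact (posteriorCov_toEuclideanLin hSx horth).trans hK

lemma posteriorCov_obsAfter_linearPolicy_eq_add_stepIncrement {A : Matrix (Fin p) (Fin p) ℝ}
    (hSx : 0 ≤ Sx) (hV : IsSelfAdjoint V) (hD : D = Sx - posteriorCov Sx (linearPolicy A))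
    (hU : U ∈ orthogonalGroup (Fin p) ℝ) (hP : stepProj V D = U * diagonal l * Uᵀ)
    (hB : Bᵀ = symPinv (psdSqrt D) * U * diagonal l) :
    posteriorCov Sx (obsAfter (linearPolicy A) (linearPolicy B)) =
      posteriorCov Sx (linearPolicy A) + stepIncrement V D := by
  have hDnonneg : 0 ≤ D := hD ▸ sub_nonneg.2 (posteriorCov_le hSx (measurable_linearPolicy A))
  obtain ⟨K, hK, horth⟩ := exists_gain_of_transpose_eq hV hDnonneg hU hP hB
  rw [posteriorCov_obsAfter_linearPolicy hSx (hD ▸ horth), ← hD, hK]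

lemma exists_measurable_posteriorCov_eq_stepIncrement (hSx : 0 ≤ Sx) (hV : IsSelfAdjoint V) :
    ∃ η : E p → E p, Measurable η ∧ posteriorCov Sx η = stepIncrement V Sx := by
  have hherm : (stepProj V Sx).IsHermitian := (isStarProjection_stepProj V Sx).isSelfAdjoint
  refine ⟨linearPolicy (symPinv (psdSqrt Sx) * hherm.eigenvectorUnitary *
    diagonal hherm.eigenvalues)ᵀ, measurable_linearPolicy _,
    posteriorCov_linearPolicy_eq_stepIncrement hSx hV hherm.eigenvectorUnitary.2 ?_
      (transpose_transpose _)⟩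
  exact hherm.spectral_theorem

lemma isStackelberg_obsSingle_iff (hSx : 0 ≤ Sx) (hRr : IsUnit (Rrᵀ * Rr)) {η : E p → E p}
    (hη : Measurable η) {γ : (E p → E p) → E p → E t}
    (hγ : IsReceiverReaction Sx Qr Rr obsSingle γ) :
    IsStackelberg Sx Q R Qr Rr obsSingle η γ ↔
      (costMatrix Q R Qr Rr * posteriorCov Sx η).trace ≤
        (costMatrix Q R Qr Rr * stepIncrement (costMatrix Q R Qr Rr) Sx).trace := by
  rw [isStackelberg_iff (obs := obsSingle) hSx hRr (fun _ h ↦ h) hη hγ]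
  constructor
  · intro h
    obtain ⟨η₀, hη₀, hcov⟩ :=
      exists_measurable_posteriorCov_eq_stepIncrement hSx (isSelfAdjoint_costMatrix (Q := Q)
        (R := R) (Qr := Qr) (Rr := Rr))
    exact hcov ▸ h η₀ hη₀
  · exact fun h η' hη' ↦ h.trans (trace_mul_stepIncrement_le isSelfAdjoint_costMatrix
      (posteriorCov_nonneg _) (posteriorCov_le hSx hη'))

lemma isBaseEquilibrium_iff (hSx : 0 ≤ Sx) (hRr : IsUnit (Rrᵀ * Rr)) {η : E p → E p}
    (hη : Measurable η) {γ : (E p → E p) → E p → E t}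
    (hγ : IsReceiverReaction Sx Qr Rr obsSingle γ) :
    IsBaseEquilibrium Sx Q R Qr Rr η γ ↔
      posteriorCov Sx η = stepIncrement (costMatrix Q R Qr Rr) Sx := by
  have hV : IsSelfAdjoint (costMatrix Q R Qr Rr) := isSelfAdjoint_costMatrix
  constructor
  · rintro ⟨hstack, hrank⟩
    obtain ⟨η₀, hη₀, hcov⟩ := exists_measurable_posteriorCov_eq_stepIncrement hSx hV
    have hstack₀ : IsStackelberg Sx Q R Qr Rr obsSingle η₀ γ :=
      (isStackelberg_obsSingle_iff hSx hRr hη₀ hγ).2 (by rw [hcov])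
    exact eq_stepIncrement_of_rank_le hV (posteriorCov_nonneg η) (posteriorCov_le hSx hη)
      ((isStackelberg_obsSingle_iff hSx hRr hη hγ).1 hstack) (hcov ▸ hrank η₀ hstack₀)
  · intro hcov
    refine ⟨(isStackelberg_obsSingle_iff hSx hRr hη hγ).2 (by rw [hcov]), fun η' h' ↦ ?_⟩
    rw [hcov]
    exact rank_stepIncrement_le hV (posteriorCov_nonneg η') (posteriorCov_le hSx h'.measurable)
      ((isStackelberg_obsSingle_iff hSx hRr h'.measurable hγ).1 h')

lemma exists_isBaseEquilibrium_linearPolicy (hSx : 0 ≤ Sx) (hRr : IsUnit (Rrᵀ * Rr))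
    (hU : U ∈ orthogonalGroup (Fin p) ℝ)
    (hP : stepProj (costMatrix Q R Qr Rr) Sx = U * diagonal l * Uᵀ) :
    ∃ γ, IsBaseEquilibrium Sx Q R Qr Rr
      (linearPolicy (symPinv (psdSqrt Sx) * U * diagonal l)ᵀ) γ := by
  obtain ⟨γ, hγ⟩ := exists_isReceiverReaction (Sx := Sx) (Qr := Qr) hRr (obs := obsSingle)
    fun _ h ↦ h
  exact ⟨γ, (isBaseEquilibrium_iff hSx hRr (measurable_linearPolicy _) hγ).2
    (posteriorCov_linearPolicy_eq_stepIncrement hSx isSelfAdjoint_costMatrix hU hP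
      (transpose_transpose _))⟩

lemma IsBaseEquilibrium.posteriorCov_eq (hSx : 0 ≤ Sx) (hRr : IsUnit (Rrᵀ * Rr)) {η : E p → E p}
    {γ : (E p → E p) → E p → E t} (h : IsBaseEquilibrium Sx Q R Qr Rr η γ) :
    posteriorCov Sx η = stepIncrement (costMatrix Q R Qr Rr) Sx :=
  (isBaseEquilibrium_iff hSx hRr h.stackelberg.measurable h.stackelberg.reaction).1 h

lemma isStackelberg_obsAfter (hSx : 0 ≤ Sx) (hRr : IsUnit (Rrᵀ * Rr)) {η₁ η : E p → E p}
    (hη₁ : Measurable η₁) (hη : Measurable η) {γ : (E p → E p) → E p × E p → E t}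
    (hγ : IsReceiverReaction Sx Qr Rr (obsAfter η₁) γ)
    (hcov : posteriorCov Sx (obsAfter η₁ η) = posteriorCov Sx η₁ +
      stepIncrement (costMatrix Q R Qr Rr) (Sx - posteriorCov Sx η₁)) :
    IsStackelberg Sx Q R Qr Rr (obsAfter η₁) η γ := by
  refine (isStackelberg_iff hSx hRr (fun _ h ↦ measurable_obsAfter hη₁ h) hη hγ).2 fun η' hη' ↦ ?_
  rw [hcov]
  exact trace_mul_add_stepIncrement_le isSelfAdjoint_costMatrix (le_posteriorCov_obsAfter hη₁ hη')
    (posteriorCov_le hSx (measurable_obsAfter hη₁ hη'))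

end Equilibrium

end SenderGame

open SenderGame in
open scoped MatrixOrder in
theorem theorem2_general {p q t : ℕ}
    (Sx : Matrix (Fin p) (Fin p) ℝ) (hSx : Sx.PosSemidef)
    (Q₁ Q₂ Qr : Matrix (Fin q) (Fin p) ℝ) (R₁ R₂ Rr : Matrix (Fin q) (Fin t) ℝ)
    (hRr : IsUnit (Rrᵀ * Rr)) :
    (∃ S₁ S, AlgorithmRun Sx (costMatrix Q₁ R₁ Qr Rr) (costMatrix Q₂ R₂ Qr Rr) S₁ S) ∧
    ∀ S₁ S : Matrix (Fin p) (Fin p) ℝ,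
      AlgorithmRun Sx (costMatrix Q₁ R₁ Qr Rr) (costMatrix Q₂ R₂ Qr Rr) S₁ S →
      IsStable Sx (costMatrix Q₁ R₁ Qr Rr) S ∧
      IsStable Sx (costMatrix Q₂ R₂ Qr Rr) S ∧
      (∀ (U : Matrix (Fin p) (Fin p) ℝ) (l : Fin p → ℝ),
        U ∈ orthogonalGroup (Fin p) ℝ →
        symPinv (psdSqrt Sx) * S₁ * symPinv (psdSqrt Sx) = U * diagonal l * Uᵀ →
        ∃ γ₁ : (E p → E p) → E p → E t,
          IsBaseEquilibrium Sx Q₁ R₁ Qr Rr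
            (linearPolicy (symPinv (psdSqrt Sx) * U * diagonal l)ᵀ) γ₁) ∧
      ∀ (η₁ : E p → E p) (γ₁ : (E p → E p) → E p → E t) (C₁ Pt : Matrix (Fin p) (Fin p) ℝ),
        IsBaseEquilibrium Sx Q₁ R₁ Qr Rr η₁ γ₁ →
        C₁ = posteriorCov Sx η₁ →
        Pt = symPinv (psdSqrt (Sx - C₁)) * (S - C₁) * symPinv (psdSqrt (Sx - C₁)) →
        C₁ = S₁ ∧
        (Ptᵀ = Pt ∧ Pt * Pt = Pt) ∧
        S = C₁ + psdSqrt (Sx - C₁) * Pt * psdSqrt (Sx - C₁) ∧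
        (∃ γ : (E p → E p) → E p × E p → E t, IsReceiverReaction Sx Qr Rr (obsAfter η₁) γ) ∧
        ∀ (A U B : Matrix (Fin p) (Fin p) ℝ) (l : Fin p → ℝ),
          η₁ = linearPolicy A →
          U ∈ orthogonalGroup (Fin p) ℝ →
          Pt = U * diagonal l * Uᵀ →
          Bᵀ = symPinv (psdSqrt (Sx - C₁)) * U * diagonal l →
          (∀ γ : (E p → E p) → E p × E p → E t,
            IsReceiverReaction Sx Qr Rr (obsAfter η₁) γ →
            IsStackelberg Sx Q₂ R₂ Qr Rr (obsAfter η₁) (linearPolicy B) γ) ∧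
          posteriorCov Sx (obsAfter η₁ (linearPolicy B)) = S := by
  have hSx₀ : 0 ≤ Sx := hSx.nonneg
  have hV₁ : IsSelfAdjoint (costMatrix Q₁ R₁ Qr Rr) := isSelfAdjoint_costMatrix
  have hV₂ : IsSelfAdjoint (costMatrix Q₂ R₂ Qr Rr) := isSelfAdjoint_costMatrix
  simp only [algorithmRun_iff hV₁ hV₂]
  refine ⟨⟨_, _, rfl, rfl⟩, ?_⟩
  rintro _ _ ⟨rfl, rfl⟩
  have hstable₁ := isStable_stepIncrement hV₁ hSx₀
  have hle := stepIncrement_le (costMatrix Q₁ R₁ Qr Rr) hSx₀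
  refine ⟨hstable₁.mono (le_add_of_nonneg_right (stepIncrement_nonneg _ _))
    (add_stepIncrement_le _ hle), isStable_add_stepIncrement hV₂ hstable₁.nonneg.nonneg hle,
    fun U l hU hP ↦ exists_isBaseEquilibrium_linearPolicy hSx₀ hRr hU
      ((whiten_stepIncrement hV₁ Sx).symm.trans hP), ?_⟩
  rintro η₁ γ₁ _ Pt hη₁ rfl hPt
  have hη₁m := hη₁.stackelberg.measurable
  rw [← hη₁.posteriorCov_eq hSx₀ hRr] at hPt ⊢
  obtain rfl : Pt = stepProj (costMatrix Q₂ R₂ Qr Rr) (Sx - posteriorCov Sx η₁) := by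
    rw [hPt, add_sub_cancel_left]
    exact whiten_stepIncrement hV₂ _
  have hproj := isStarProjection_stepProj (costMatrix Q₂ R₂ Qr Rr) (Sx - posteriorCov Sx η₁)
  refine ⟨rfl, ⟨hproj.isSelfAdjoint, hproj.isIdempotentElem⟩, rfl,
    exists_isReceiverReaction hRr fun _ ↦ measurable_obsAfter hη₁m, ?_⟩
  rintro A U B l rfl hU hP hB
  have hcov := posteriorCov_obsAfter_linearPolicy_eq_add_stepIncrement hSx₀ hV₂ rfl hU hP hB
  exact ⟨fun γ hγ ↦ isStackelberg_obsAfter hSx₀ hRr hη₁m (measurable_linearPolicy B) hγ hcov, hcov⟩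

theorem theorem2 {p q t : ℕ}
    (Sx : Matrix (Fin p) (Fin p) ℝ) (hSx : Sx.PosDef)
    (Q₁ Q₂ Qr : Matrix (Fin q) (Fin p) ℝ) (R₁ R₂ Rr : Matrix (Fin q) (Fin t) ℝ)
    (hRr : IsUnit (Rrᵀ * Rr)) :
    -- the algorithm can be run
    (∃ S₁ S, SenderGame.AlgorithmRun Sx (SenderGame.costMatrix Q₁ R₁ Qr Rr)
      (SenderGame.costMatrix Q₂ R₂ Qr Rr) S₁ S) ∧
    ∀ S₁ S : Matrix (Fin p) (Fin p) ℝ,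
      SenderGame.AlgorithmRun Sx (SenderGame.costMatrix Q₁ R₁ Qr Rr)
        (SenderGame.costMatrix Q₂ R₂ Qr Rr) S₁ S →
      -- its output is stable for both senders
      SenderGame.IsStable Sx (SenderGame.costMatrix Q₁ R₁ Qr Rr) S ∧
      SenderGame.IsStable Sx (SenderGame.costMatrix Q₂ R₂ Qr Rr) S ∧
      -- the base game has the linear equilibrium `Aᵀ = Sx^{-1/2} U Λ`
      (∀ (U : Matrix (Fin p) (Fin p) ℝ) (l : Fin p → ℝ),
        U ∈ Matrix.orthogonalGroup (Fin p) ℝ →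
        (SenderGame.psdSqrt Sx)⁻¹ * S₁ * (SenderGame.psdSqrt Sx)⁻¹
          = U * Matrix.diagonal l * Uᵀ →
        ∃ γ₁ : (SenderGame.E p → SenderGame.E p) → SenderGame.E p → SenderGame.E t,
          SenderGame.IsBaseEquilibrium Sx Q₁ R₁ Qr Rr
            (SenderGame.linearPolicy ((SenderGame.psdSqrt Sx)⁻¹ * U * Matrix.diagonal l)ᵀ) γ₁) ∧
      -- the base-game equilibrium posterior is `C₁ = S₁`, and `Pt` is an orthogonal projection
      ∀ (η₁ : SenderGame.E p → SenderGame.E p)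
        (γ₁ : (SenderGame.E p → SenderGame.E p) → SenderGame.E p → SenderGame.E t)
        (C₁ Pt : Matrix (Fin p) (Fin p) ℝ),
        SenderGame.IsBaseEquilibrium Sx Q₁ R₁ Qr Rr η₁ γ₁ →
        C₁ = SenderGame.posteriorCov Sx η₁ →
        Pt = SenderGame.symPinv (SenderGame.psdSqrt (Sx - C₁)) * (S - C₁) *
          SenderGame.symPinv (SenderGame.psdSqrt (Sx - C₁)) →
        C₁ = S₁ ∧
        (Ptᵀ = Pt ∧ Pt * Pt = Pt) ∧
        S = C₁ + SenderGame.psdSqrt (Sx - C₁) * Pt * SenderGame.psdSqrt (Sx - C₁) ∧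
        -- the receiver has a best response to every policy of sender 2
        (∃ γ : (SenderGame.E p → SenderGame.E p) → SenderGame.E p × SenderGame.E p →
            SenderGame.E t,
          SenderGame.IsReceiverReaction Sx Qr Rr (SenderGame.obsAfter η₁) γ) ∧
        -- if sender 1 has committed to a linear policy `x ↦ A x`, then
        -- `Bᵀ = (Sx - C₁)^{†1/2} U Λ` gives an equilibrium with posterior covariance `S`
        ∀ (A U B : Matrix (Fin p) (Fin p) ℝ) (l : Fin p → ℝ),
          η₁ = SenderGame.linearPolicy A →
          U ∈ Matrix.orthogonalGroup (Fin p) ℝ →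
          Pt = U * Matrix.diagonal l * Uᵀ →
          Bᵀ = SenderGame.symPinv (SenderGame.psdSqrt (Sx - C₁)) * U * Matrix.diagonal l →
          (∀ γ : (SenderGame.E p → SenderGame.E p) → SenderGame.E p × SenderGame.E p →
              SenderGame.E t,
            SenderGame.IsReceiverReaction Sx Qr Rr (SenderGame.obsAfter η₁) γ →
            SenderGame.IsStackelberg Sx Q₂ R₂ Qr Rr (SenderGame.obsAfter η₁)
              (SenderGame.linearPolicy B) γ) ∧
          SenderGame.posteriorCov Sx
            (SenderGame.obsAfter η₁ (SenderGame.linearPolicy B)) = S := by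
  simpa only [← SenderGame.symPinv_psdSqrt_eq_inv hSx] using
    theorem2_general Sx hSx.posSemidef Q₁ Q₂ Qr R₁ R₂ Rr hRr
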